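/- Let $\vartheta=\frac{-1+\sqrt5}{2}$, $R=\mathbb Z[\vartheta]$ the ring of integers of $K=\mathbb Q(\sqrt5)$, $\sigma_1,\sigma_2$ the two real embeddings of $K$, $\mathrm{Tr}=\mathrm{Tr}_{K/\mathbb Q}$, and $\eta=3+\vartheta=\frac{5+\sqrt5}{2}$. A symmetric Hilbert modular form of weight $w\in\mathbb Z_{\ge 0}$ for $\mathrm{SL}_2(R)$ is a holomorphic function $f$ on $\mathbb H\times\mathbb H$ with $f(z_2,z_1)=f(z_1,z_2)$ and $$f\left(\frac{\sigma_1(a)z_1+\sigma_1(b)}{\sigma_1(c)z_1+\sigma_1(d)},\frac{\sigma_2(a)z_2+\sigma_2(b)}{\sigma_2(c)z_2+\sigma_2(d)}\right)=(\sigma_1(c)z_1+\sigma_1(d))^w(\sigma_2(c)z_2+\sigma_2(d))^w f(z_1,z_2)$$ for all $\begin{pmatrix}a&b\\c&d\end{pmatrix}\in\mathrm{SL}_2(R)$. A holomorphic $R$-periodic function $g$ on $\mathbb H\times\mathbb H$ has a Fourier expansion $$g(z_1,z_2)=\sum_{X\in R}A_X\,e^{2\pi i\left(z_1\sigma_1(\eta^{-1}X)+z_2\sigma_2(\eta^{-1}X)\right)},$$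 and its $(q_0,q_1)$-expansion is $\sum_{X\in R}A_X\,q_0^{\mathrm{Tr}(\eta^{-1}X)}q_1^{\mathrm{Tr}(X)}$. The exponents are integers, and they determine $X$. Write $\nu(g)=(i,j)\in\mathbb Z\times\mathbb Z$ for the smallest pair of exponents with a non-zero coefficient, where $\mathbb Z\times\mathbb Z$ is ordered lexicographically. Let $f$ be a symmetric Hilbert modular form of weight $w$ for $\mathrm{SL}_2(R)$ with $f\ne 1$, and put $s:=1+\lfloor w/6\rfloor$ and $t:=\lfloor 5s/2\rfloor$. Then $\nu(f-1)$ exists, and if $\nu(f-1)=(s',t')$, then $$s'\le s,\qquad \left\lfloor \tfrac{5s'}{2}\right\rfloor\ge t'\ge 2s' .$$ In particular $\nu(f-1)\le(s,t)$ in the lexicographic order. -/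

import Mathlib

noncomputable section

namespace GoldenHilbert

open UpperHalfPlane

/-- The ring `R = ℤ[ϑ]`, `ϑ = (-1 + √5) / 2`: the elements `x + y ϑ` with `x y : ℤ`, multiplied by
the rule `ϑ ^ 2 = 1 - ϑ`. It is the ring of integers of `K = ℚ(√5)`. -/
abbrev R : Type := QuadraticAlgebra ℤ 1 (-1)

/-- The golden ratio `ϑ` as an element of `R`. -/
def vartheta : R := ⟨0, 1⟩

/-- The totally positive element `η = 3 + ϑ = (5 + √5) / 2` of norm 5; its inverse generates the
inverse different of `R`. -/
def eta : R := 3 + vartheta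

/-- The first real embedding of `R`, sending `ϑ` to `(-1 + √5) / 2`. -/
def sigma₁ : R →+* ℝ :=
  (QuadraticAlgebra.lift (R := ℤ) (a := 1) (b := -1) ⟨(-1 + √5) / 2, by
    have h : √5 * √5 = (5 : ℝ) := Real.mul_self_sqrt (by norm_num)
    simp only [one_smul, zsmul_eq_mul, Int.cast_neg, Int.cast_one]
    linarith⟩ : R →ₐ[ℤ] ℝ).toRingHom

/-- The second real embedding of `R`, sending `ϑ` to `(-1 - √5) / 2`. -/
def sigma₂ : R →+* ℝ :=
  (QuadraticAlgebra.lift (R := ℤ) (a := 1) (b := -1) ⟨(-1 - √5) / 2, by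
    have h : √5 * √5 = (5 : ℝ) := Real.mul_self_sqrt (by norm_num)
    simp only [one_smul, zsmul_eq_mul, Int.cast_neg, Int.cast_one]
    linarith⟩ : R →ₐ[ℤ] ℝ).toRingHom

/-- `Trace_{K/ℚ}(X)`, as a real number. -/
def trace (X : R) : ℝ := sigma₁ X + sigma₂ X

/-- `Trace_{K/ℚ}(η⁻¹ X)`, as a real number. -/
def traceEtaInv (X : R) : ℝ := sigma₁ X / sigma₁ eta + sigma₂ X / sigma₂ eta

/-- The action of `SL₂(R)` on `ℍ × ℍ` by Möbius transformations through the two embeddings. -/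
def act (M : Matrix.SpecialLinearGroup (Fin 2) R) (z : ℍ × ℍ) : ℍ × ℍ :=
  (Matrix.SpecialLinearGroup.map sigma₁ M • z.1, Matrix.SpecialLinearGroup.map sigma₂ M • z.2)

/-- `f` is a Hilbert modular form of (parallel) weight `w` for the group `SL₂(R)`: a holomorphic
function on `ℍ × ℍ` with the transformation law of weight `w`. (Regularity at the cusp is automatic
for two variables, by the Koecher principle, and is not a part of the definition.) -/
structure IsHilbertModularForm (w : ℕ) (f : ℍ × ℍ → ℂ) : Prop where
  holomorphic : DifferentiableOn ℂ (fun p : ℂ × ℂ => f (ofComplex p.1, ofComplex p.2))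
    {p : ℂ × ℂ | 0 < p.1.im ∧ 0 < p.2.im}
  transform : ∀ (M : Matrix.SpecialLinearGroup (Fin 2) R) (z : ℍ × ℍ),
    f (act M z) =
      (((sigma₁ (M 1 0) : ℂ) * z.1 + sigma₁ (M 1 1)) *
        ((sigma₂ (M 1 0) : ℂ) * z.2 + sigma₂ (M 1 1))) ^ w * f z

/-- A Hilbert modular form is symmetric if it is invariant under the Galois automorphism, which
interchanges the two copies of the upper half plane. -/
structure IsSymmetricHilbertModularForm (w : ℕ) (f : ℍ × ℍ → ℂ) : Prop
    extends IsHilbertModularForm w f where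
  symm : ∀ z₁ z₂ : ℍ, f (z₂, z₁) = f (z₁, z₂)

/-- The Fourier coefficient `A_X` of an `R`-periodic holomorphic function `g` on `ℍ × ℍ`, that is,
the coefficients of
`g(z) = ∑_{X ∈ R} A_X exp (2πi Trace(η⁻¹ X z))`, where
`Trace(η⁻¹ X z) = z₁ σ₁(X) / σ₁(η) + z₂ σ₂(X) / σ₂(η)`
(as `η⁻¹ R` is the dual of the translation lattice `R` under the trace form, these are all the
exponentials that are invariant under `R`). The integral is over the fundamental parallelogram
`{x + y ϑ | x, y ∈ [0, 1]}` of the lattice `R`, at height `Im z = (1, 1)`. -/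
def hilbertCoeff (g : ℍ × ℍ → ℂ) (X : R) : ℂ :=
  ∫ x in (0 : ℝ)..1, ∫ y in (0 : ℝ)..1,
    let z₁ : ℍ := (x + y * sigma₁ vartheta) +ᵥ I
    let z₂ : ℍ := (x + y * sigma₂ vartheta) +ᵥ I
    g (z₁, z₂) * Complex.exp (-(2 * Real.pi * Complex.I *
      ((z₁ : ℂ) * (sigma₁ X / sigma₁ eta : ℝ) + (z₂ : ℂ) * (sigma₂ X / sigma₂ eta : ℝ))))

/-- The support of the `(q₀, q₁)`-expansion `∑_X A_X q₀ ^ Trace(η⁻¹ X) q₁ ^ Trace(X)` of `g`, as a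
subset of `ℤ × ℤ` with the lexicographic order. The two exponents are integers, and determine `X`,
so that no two terms of the series have the same exponents. -/
def qSupport (g : ℍ × ℍ → ℂ) : Set (ℤ ×ₗ ℤ) :=
  {p | ∃ X : R, hilbertCoeff g X ≠ 0 ∧
    traceEtaInv X = ((ofLex p).1 : ℝ) ∧ trace X = ((ofLex p).2 : ℝ)}

/-- `ν(g) = (s, t)`: the pair `(s, t)` is the lexicographically least exponent with a non-zero
coefficient in the `(q₀, q₁)`-expansion of `g`. -/
def HasNu (g : ℍ × ℍ → ℂ) (s t : ℤ) : Prop :=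
  IsLeast (qSupport g) (toLex (s, t))

end GoldenHilbert

end

noncomputable section

namespace PowerSeries

open scoped ComplexOrder

/-- The Euler derivation `q d/dq` on complex power series. -/
def euler : Derivation ℂ ℂ⟦X⟧ ℂ⟦X⟧ := (X : ℂ⟦X⟧) • derivative ℂ

@[simp]
lemma coeff_euler (p : ℂ⟦X⟧) (n : ℕ) : coeff n (euler p) = n * coeff n p := by
  rw [euler, Derivation.smul_apply, smul_eq_mul]
  cases n with
  | zero => simp
  | succ n => rw [coeff_succ_X_mul, coeff_derivative]; push_cast; ring

lemma coeff_mul_nonneg {p q : ℂ⟦X⟧} (hp : ∀ n, 0 ≤ coeff n p) (hq : ∀ n, 0 ≤ coeff n q) (n : ℕ) :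
    0 ≤ coeff n (p * q) := by
  rw [coeff_mul]
  exact Finset.sum_nonneg fun x _ => mul_nonneg (hp _) (hq _)

lemma coeff_pow_nonneg {p : ℂ⟦X⟧} (hp : ∀ n, 0 ≤ coeff n p) (k n : ℕ) :
    0 ≤ coeff n (p ^ k) := by
  induction k generalizing n with
  | zero => rw [pow_zero, coeff_one]; split_ifs <;> simp
  | succ k ih => rw [pow_succ]; exact coeff_mul_nonneg ih hp n

lemma coeff_mul_pos {p q : ℂ⟦X⟧} {n : ℕ} (hp : ∀ n, 0 ≤ coeff n p) (hq : ∀ n, 0 ≤ coeff n q)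
    (hpn : 0 < coeff n p) (hq0 : constantCoeff q = 1) : 0 < coeff n (p * q) := by
  rw [coeff_mul]
  refine lt_of_lt_of_le hpn ?_
  have := Finset.single_le_sum (f := fun x : ℕ × ℕ => coeff x.1 p * coeff x.2 q)
    (s := Finset.HasAntidiagonal.antidiagonal n) (fun x _ => mul_nonneg (hp _) (hq _))
    (a := (n, 0)) (by simp)
  simpa [hq0] using this

lemma coeff_pow_pos {p : ℂ⟦X⟧} (hp : ∀ n, 0 < coeff n p) (hp0 : constantCoeff p = 1)
    {k : ℕ} (hk : k ≠ 0) (n : ℕ) : 0 < coeff n (p ^ k) := by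
  obtain ⟨k, rfl⟩ := Nat.exists_eq_succ_of_ne_zero hk
  rw [pow_succ']
  exact coeff_mul_pos (fun n => (hp n).le) (coeff_pow_nonneg (fun n => (hp n).le) _) (hp n)
    (by simp [hp0])

/-- A solution of `q dv/dq = d v` has positive coefficients if `d` has. -/
lemma coeff_pos_of_euler_eq {v d : ℂ⟦X⟧} (hv : euler v = d * v) (hv0 : constantCoeff v = 1)
    (hd0 : constantCoeff d = 0) (hd : ∀ n, n ≠ 0 → 0 < coeff n d) (n : ℕ) : 0 < coeff n v := by
  induction n using Nat.strong_induction_on with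
  | _ n ih =>
    rcases Nat.eq_zero_or_pos n with rfl | hn
    · simp [hv0]
    have h1 := congrArg (coeff n) hv
    rw [coeff_euler, coeff_mul] at h1
    have hterm : ∀ x ∈ Finset.HasAntidiagonal.antidiagonal n, 0 ≤ coeff x.1 d * coeff x.2 v := by
      intro x hx
      rcases Nat.eq_zero_or_pos x.1 with h0 | h0
      · rw [h0]; simp [hd0]
      · have := Finset.HasAntidiagonal.mem_antidiagonal.1 hx
        exact mul_nonneg (hd _ h0.ne').le (ih _ (by omega)).le
    have h2 := Finset.single_le_sum hterm (a := (n, 0)) (by simp)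
    have h3 : 0 < (n : ℂ) * coeff n v := by
      rw [h1]
      refine lt_of_lt_of_le ?_ h2
      simpa [hv0] using hd n hn.ne'
    have h4 : (0 : ℂ) < (n : ℂ)⁻¹ := by
      rw [← Complex.ofReal_natCast, ← Complex.ofReal_inv]
      exact_mod_cast inv_pos.2 (by exact_mod_cast hn)
    have h5 := mul_pos h4 h3
    rwa [← mul_assoc, inv_mul_cancel₀ (by exact_mod_cast hn.ne'), one_mul] at h5

section Ramanujan

variable {e₂ e₄ e₆ v : ℂ⟦X⟧}

lemma euler_pow_of_euler_eq (hv : euler v = (1 - e₂) * v) (r : ℕ) :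
    euler (v ^ r) = r * ((1 - e₂) * v ^ r) := by
  rw [Derivation.leibniz_pow, hv]
  cases r with
  | zero => simp
  | succ r =>
    simp only [smul_eq_mul, nsmul_eq_mul, Nat.add_sub_cancel]
    ring

lemma coeff_ramanujan_exact (hv : euler v = (1 - e₂) * v) (h₄ : 3 * euler e₄ = e₂ * e₄ - e₆)
    {r : ℕ} (hr : r ≠ 0) : coeff r (e₄ ^ (3 * r - 1) * e₆ * v ^ r) = 0 := by
  have h1 : euler (e₄ ^ (3 * r) * v ^ r) - (r : ℂ⟦X⟧) * (e₄ ^ (3 * r) * v ^ r) =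
      -((r : ℂ⟦X⟧) * (e₄ ^ (3 * r - 1) * e₆ * v ^ r)) := by
    rw [Derivation.leibniz, euler_pow_of_euler_eq hv, Derivation.leibniz_pow]
    obtain ⟨m, hm⟩ : ∃ m, 3 * r = m + 1 := ⟨3 * r - 1, by omega⟩
    have hm' : (3 : ℂ⟦X⟧) * r = m + 1 := by
      simpa using congrArg (Nat.cast (R := ℂ⟦X⟧)) hm
    simp only [smul_eq_mul, nsmul_eq_mul, hm, Nat.add_sub_cancel]
    push_cast
    rw [← hm']
    linear_combination (r : ℂ⟦X⟧) * v ^ r * e₄ ^ m * h₄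
  have h2 := congrArg (coeff r) h1
  have hc : ∀ p : ℂ⟦X⟧, coeff r ((r : ℂ⟦X⟧) * p) = r * coeff r p := fun p => by
    rw [← map_natCast (C (R := ℂ)), coeff_C_mul]
  rw [map_sub, coeff_euler, hc, sub_self, map_neg, hc] at h2
  have : (r : ℂ) ≠ 0 := by exact_mod_cast hr
  simpa [this] using h2.symm

lemma coeff_ramanujan_even_ne_zero (hv0 : constantCoeff v = 1) (hvpos : ∀ n, 0 < coeff n v)
    (h₄0 : constantCoeff e₄ = 1) (h₄pos : ∀ n, 0 < coeff n e₄) (i r : ℕ) :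
    coeff r (e₄ ^ i * v ^ r) ≠ 0 := by
  rcases eq_or_ne r 0 with rfl | hr
  · simp [h₄0]
  rw [mul_comm]
  exact (coeff_mul_pos (coeff_pow_nonneg (fun n => (hvpos n).le) _)
    (coeff_pow_nonneg (fun n => (h₄pos n).le) _) (coeff_pow_pos hvpos hv0 hr r) (by simp [h₄0])).ne'

lemma coeff_ramanujan_odd_ne_zero (hv : euler v = (1 - e₂) * v)
    (h₄ : 3 * euler e₄ = e₂ * e₄ - e₆)
    (hv0 : constantCoeff v = 1) (hvpos : ∀ n, 0 < coeff n v)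
    (h₄0 : constantCoeff e₄ = 1) (h₄pos : ∀ n, 0 < coeff n e₄) {i r : ℕ} (hr : r ≠ 0)
    (hir : i + 1 ≠ 3 * r) :
    coeff r (e₄ ^ i * e₆ * v ^ r) ≠ 0 := by
  have hc : ∀ (m : ℕ) (p : ℂ⟦X⟧), coeff r ((m : ℂ⟦X⟧) * p) = m * coeff r p := fun m p => by
    rw [← map_natCast (C (R := ℂ)), coeff_C_mul]
  have h1 : ((i + 1 : ℕ) : ℂ⟦X⟧) * ((r : ℂ⟦X⟧) * (e₄ ^ i * e₆ * v ^ r)) +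
      ((3 : ℕ) : ℂ⟦X⟧) * ((r : ℂ⟦X⟧) * (euler (e₄ ^ (i + 1)) * v ^ r)) =
      ((i + 1 : ℕ) : ℂ⟦X⟧) * ((r : ℂ⟦X⟧) * (e₄ ^ (i + 1) * v ^ r)) -
        ((i + 1 : ℕ) : ℂ⟦X⟧) * (e₄ ^ (i + 1) * euler (v ^ r)) := by
    rw [euler_pow_of_euler_eq hv, Derivation.leibniz_pow]
    simp only [smul_eq_mul, nsmul_eq_mul, Nat.add_sub_cancel]
    push_cast
    linear_combination ((i : ℂ⟦X⟧) + 1) * r * e₄ ^ i * v ^ r * h₄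
  have h2 := congrArg (coeff r) (Derivation.leibniz euler (e₄ ^ (i + 1)) (v ^ r))
  have h3 := congrArg (coeff r) h1
  simp only [map_add, map_sub, hc, coeff_euler, smul_eq_mul] at h2 h3
  have hpos : 0 < coeff r (euler (e₄ ^ (i + 1)) * v ^ r) := by
    refine coeff_mul_pos (fun n => ?_) (coeff_pow_nonneg (fun n => (hvpos n).le) _) ?_ (by simp [hv0])
    · rw [coeff_euler]
      exact mul_nonneg (by positivity) (coeff_pow_nonneg (fun n => (h₄pos n).le) _ _)
    · rw [coeff_euler]
      have : (0 : ℂ) < r := by exact_mod_cast Nat.pos_of_ne_zero hr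
      exact mul_pos this (coeff_pow_pos h₄pos h₄0 (Nat.succ_ne_zero i) r)
  intro h0
  rw [h0] at h3
  rw [mul_comm (v ^ r)] at h2
  have h4 : (((i + 1 : ℕ) : ℂ) - 3 * r) * coeff r (euler (e₄ ^ (i + 1)) * v ^ r) = 0 := by
    push_cast at h2 h3 ⊢
    linear_combination (-(i : ℂ) - 1) * h2 - h3
  rcases mul_eq_zero.1 h4 with h | h
  · exact hir (by exact_mod_cast sub_eq_zero.1 h)
  · exact hpos.ne' h

end Ramanujan

end PowerSeries
end

noncomputable section

namespace LevelOne

open UpperHalfPlane ModularForm ModularFormClass MatrixGroups Filter EisensteinSeries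
open Derivative
open scoped Topology Manifold PowerSeries ArithmeticFunction.sigma ComplexOrder

/-- `F` is the sum of the `q`-series with coefficients `p` on the whole upper half plane. -/
def HasQSeries (F : ℍ → ℂ) (p : ℂ⟦X⟧) : Prop :=
  ∀ τ : ℍ, HasSum (fun m => p.coeff m • Function.Periodic.qParam 1 τ ^ m) (F τ)

namespace HasQSeries

variable {F G : ℍ → ℂ} {p r : ℂ⟦X⟧}

lemma sub (hF : HasQSeries F p) (hG : HasQSeries G r) : HasQSeries (F - G) (p - r) := fun τ => by
  simpa [sub_mul] using (hF τ).sub (hG τ)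

lemma smul (hF : HasQSeries F p) (c : ℂ) : HasQSeries (c • F) (c • p) := fun τ => by
  simpa [mul_assoc] using (hF τ).mul_left c

lemma mul (hF : HasQSeries F p) (hG : HasQSeries G r) : HasQSeries (F * G) (p * r) := fun τ => by
  have h1 := (hF τ).summable.norm
  have h2 := (hG τ).summable.norm
  have h := (summable_norm_sum_mul_antidiagonal_of_summable_norm h1 h2).of_norm.hasSum
  rw [← tsum_mul_tsum_eq_tsum_sum_antidiagonal_of_summable_norm h1 h2, (hF τ).tsum_eq,
    (hG τ).tsum_eq] at h
  refine h.congr_fun fun n => ?_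
  rw [PowerSeries.coeff_mul, Finset.sum_smul]
  refine Finset.sum_congr rfl fun x hx => ?_
  rw [← Finset.HasAntidiagonal.mem_antidiagonal.1 hx, pow_add]
  simp only [smul_eq_mul]
  ring

lemma unique (hF : HasQSeries F p) (hF' : HasQSeries F r) : p = r := by
  have h : HasQSeries 0 (p - r) := by simpa using hF.sub hF'
  rw [← sub_eq_zero]
  ext m
  have h0 := ModularFormClass.qExpansion_coeff_unique (f := (0 : ModularForm 𝒮ℒ 0)) one_pos
    one_mem_strictPeriods_SL h m
  rw [h0]
  simp [qExpansion_zero]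

end HasQSeries

lemma hasQSeries_qExpansion {k : ℤ} (f : ModularForm 𝒮ℒ k) : HasQSeries f (qExpansion 1 f) :=
  fun τ => ModularForm.hasSum_qExpansion f one_pos one_mem_strictPeriods_SL τ

lemma hasQSeries_derivative {k : ℤ} (f : ModularForm 𝒮ℒ k) :
    HasQSeries (normalizedDerivOfComplex f) (PowerSeries.euler (qExpansion 1 f)) := by
  intro τ
  set C := cuspFunction 1 f with hC
  set q := Function.Periodic.qParam 1 τ with hq
  have hq1 : ‖q‖ < 1 := Function.Periodic.norm_qParam_lt_one one_pos τ.im_pos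
  have hCd : DifferentiableOn ℂ C (Metric.ball 0 1) := fun z hz =>
    (ModularFormClass.differentiableAt_cuspFunction f one_pos one_mem_strictPeriods_SL
      (mem_ball_zero_iff.1 hz)).differentiableWithinAt
  have hval : normalizedDerivOfComplex f τ = q * deriv C q := by
    have h1 : (f : ℍ → ℂ) ∘ ofComplex =ᶠ[𝓝 (τ : ℂ)] C ∘ Function.Periodic.qParam 1 := by
      filter_upwards [isOpen_upperHalfPlaneSet.mem_nhds τ.im_pos] with z hz
      have := SlashInvariantFormClass.eq_cuspFunction f ⟨z, hz⟩ one_mem_strictPeriods_SL one_ne_zero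
      rw [Function.comp_apply, Function.comp_apply, ofComplex_apply_of_im_pos hz, ← this]
    have h2 : HasDerivAt (Function.Periodic.qParam 1) (q * (2 * Real.pi * Complex.I)) (τ : ℂ) := by
      have := ((hasDerivAt_id (τ : ℂ)).const_mul (2 * Real.pi * Complex.I)).cexp
      have h0 : Function.Periodic.qParam 1 =
          fun x : ℂ => Complex.exp (2 * Real.pi * Complex.I * x) := by
        ext x; simp [Function.Periodic.qParam]
      rw [hq, h0]
      simpa using this
    have h3 : HasDerivAt C (deriv C q) q :=
      (hCd.differentiableAt (Metric.isOpen_ball.mem_nhds (mem_ball_zero_iff.2 hq1))).hasDerivAt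
    rw [normalizedDerivOfComplex, h1.deriv_eq, (h3.comp (τ : ℂ) h2).deriv]
    field_simp [Real.pi_ne_zero, Complex.I_ne_zero]
  have hsum := Complex.hasSum_taylorSeries_on_ball
    (hCd.deriv Metric.isOpen_ball) (mem_ball_zero_iff.2 hq1)
  rw [hval]
  have h4 := hsum.mul_left q
  rw [← hasSum_nat_add_iff' 1]
  simp only [Finset.range_one, Finset.sum_singleton, PowerSeries.coeff_euler, Nat.cast_zero,
    zero_mul, zero_smul, sub_zero]
  refine h4.congr_fun fun n => ?_
  rw [qExpansion_coeff, ← hC, iteratedDeriv_succ', Nat.factorial_succ, sub_zero, pow_succ]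
  have h5 : ((n : ℂ) + 1) ≠ 0 := Nat.cast_add_one_ne_zero n
  have h6 : (n.factorial : ℂ) ≠ 0 := by exact_mod_cast n.factorial_ne_zero
  simp only [smul_eq_mul]
  push_cast
  field_simp

/-- The `q`-expansion of the Eisenstein series of weight 2. -/
def e₂ : ℂ⟦X⟧ := .mk fun m => if m = 0 then 1 else -24 * σ 1 m

lemma hasQSeries_E2 : HasQSeries E2 e₂ := fun τ => by
  simpa only [e₂, PowerSeries.coeff_mk, Function.Periodic.qParam, Complex.ofReal_one, div_one]
    using hasSum_qExpansion_E2 (z := τ)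

lemma hasQSeries_serreDerivative {k : ℤ} (f : ModularForm 𝒮ℒ k) :
    HasQSeries (serreDerivative k f)
      (PowerSeries.euler (qExpansion 1 f) - (k * 12⁻¹ : ℂ) • (e₂ * qExpansion 1 f)) := by
  have h := (hasQSeries_derivative f).sub
    ((hasQSeries_E2.mul (hasQSeries_qExpansion f)).smul (k * 12⁻¹ : ℂ))
  convert! h using 1
  ext z
  simp [serreDerivative_apply, mul_assoc]

/-- The Serre derivative of a modular form of level one. -/
def serre {k : ℤ} (f : ModularForm 𝒮ℒ k) : ModularForm 𝒮ℒ (k + 2) where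
  toFun := serreDerivative k f
  slash_action_eq' := by
    rintro _ ⟨γ, rfl⟩
    exact serreDerivative_slash_invariant f.holo'
      (SlashInvariantFormClass.slash_action_eq f _ ⟨γ, rfl⟩)
  holo' := serreDerivative_mdifferentiable k f.holo'
  bdd_at_cusps' {c} hc := by
    rw [Subgroup.IsArithmetic.isCusp_iff_isCusp_SL2Z] at hc
    rw [OnePoint.isBoundedAt_iff_forall_SL2Z hc]
    intro γ _
    have : serreDerivative k f ∣[k + 2] γ = serreDerivative k f :=
      serreDerivative_slash_invariant f.holo'
        (SlashInvariantFormClass.slash_action_eq f _ ⟨γ, rfl⟩)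
    rw [this]
    exact isBoundedAtImInfty_of_hasSum_qExpansion one_pos (hasQSeries_serreDerivative f)

lemma qExpansion_serre {k : ℤ} (f : ModularForm 𝒮ℒ k) :
    qExpansion 1 (serre f) =
      PowerSeries.euler (qExpansion 1 f) - (k * 12⁻¹ : ℂ) • (e₂ * qExpansion 1 f) :=
  (hasQSeries_qExpansion (serre f)).unique (hasQSeries_serreDerivative f)

lemma euler_qExpansion_E₄ :
    3 * PowerSeries.euler (qExpansion 1 E₄) = e₂ * qExpansion 1 E₄ - qExpansion 1 E₆ := by
  obtain ⟨c, hc⟩ : ∃ c : ℂ, c • E₆ = serre E₄ :=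
    (finrank_eq_one_iff_of_nonzero' E₆ (E_ne_zero _ ⟨3, rfl⟩)).mp
      (Module.rank_eq_one_iff_finrank_eq_one.mp levelOne_weight_six_rank_one) _
  have h1 : c • qExpansion 1 E₆ = qExpansion 1 (serre E₄) := by
    rw [← ModularForm.qExpansion_smul one_pos one_mem_strictPeriods_SL c E₆, ← hc]
    rfl
  rw [qExpansion_serre] at h1
  have h40 : PowerSeries.coeff 0 (qExpansion 1 E₄) = 1 := E_qExpansion_coeff_zero _ ⟨2, rfl⟩
  have h60 : PowerSeries.coeff 0 (qExpansion 1 E₆) = 1 := E_qExpansion_coeff_zero _ ⟨3, rfl⟩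
  have h20 : PowerSeries.coeff 0 e₂ = 1 := by simp [e₂, -PowerSeries.coeff_zero_eq_constantCoeff]
  have h2 := congrArg (PowerSeries.coeff 0) h1
  have hc3 : c = -3⁻¹ := by
    rw [PowerSeries.coeff_smul, map_sub, PowerSeries.coeff_smul, PowerSeries.coeff_euler,
      PowerSeries.coeff_mul, h60] at h2
    simp only [Finset.HasAntidiagonal.antidiagonal_zero, Finset.sum_singleton, h20, h40] at h2
    norm_num at h2
    rw [h2]; norm_num
  ext n
  have h3 := congrArg (PowerSeries.coeff n) h1
  have h3c : (3 : ℂ⟦X⟧) = PowerSeries.C 3 := (map_ofNat _ 3).symm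
  rw [h3c, PowerSeries.coeff_C_mul]
  simp only [hc3, map_sub, PowerSeries.coeff_smul, smul_eq_mul] at h3 ⊢
  push_cast at h3
  linear_combination -3 * h3

lemma normalizedDeriv_discriminant :
    normalizedDerivOfComplex discriminant = E2 * discriminant := by
  ext z
  have h1 : discriminant ∘ ofComplex =ᶠ[𝓝 (z : ℂ)] fun w => eta w ^ 24 := by
    filter_upwards [isOpen_upperHalfPlaneSet.mem_nhds z.im_pos] with w hw
    rw [Function.comp_apply, ofComplex_apply_of_im_pos hw]
    rfl
  have h2 := (differentiableAt_eta_of_mem_upperHalfPlaneSet z.im_pos).hasDerivAt.pow 24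
  have h3 := logDeriv_eta_eq_E2 z
  rw [logDeriv_apply, div_eq_iff (eta_ne_zero z.im_pos)] at h3
  have h4 : deriv (fun w => eta w ^ 24) (z : ℂ) = _ := h2.deriv
  rw [normalizedDerivOfComplex, h1.deriv_eq, h4, h3, Pi.mul_apply, discriminant]
  field_simp
  push_cast
  ring

lemma euler_qExpansion_discriminant :
    PowerSeries.euler (qExpansion 1 discriminant) = e₂ * qExpansion 1 discriminant := by
  have h1 := hasQSeries_derivative
    (CuspForm.toModularFormₗ (CuspForm.discriminant) : ModularForm 𝒮ℒ 12)
  have h2 := hasQSeries_E2.mul (hasQSeries_qExpansion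
    (CuspForm.toModularFormₗ (CuspForm.discriminant) : ModularForm 𝒮ℒ 12))
  refine HasQSeries.unique (F := E2 * discriminant) ?_ h2
  rw [← normalizedDeriv_discriminant]
  exact h1

end LevelOne
end

noncomputable section

namespace LevelOne

open UpperHalfPlane ModularForm ModularFormClass MatrixGroups EisensteinSeries
open scoped PowerSeries ArithmeticFunction.sigma ComplexOrder

/-- The `q`-expansion of `q / Δ`. -/
def discInv : ℂ⟦X⟧ := (PowerSeries.mk fun n => PowerSeries.coeff (n + 1) (qExpansion 1 discriminant))⁻¹

lemma exists_qExpansion_discriminant : ∃ u : ℂ⟦X⟧, PowerSeries.constantCoeff u = 1 ∧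
    qExpansion 1 discriminant = PowerSeries.X * u ∧ discInv = u⁻¹ := by
  refine ⟨_, ?_, ?_, rfl⟩
  · rw [← PowerSeries.coeff_zero_eq_constantCoeff_apply, PowerSeries.coeff_mk]
    exact discriminant_qExpansion_coeff_one
  · ext n
    cases n with
    | zero =>
      rw [← CuspForm.coe_discriminant, CuspFormClass.qExpansion_coeff_zero CuspForm.discriminant
        one_pos one_mem_strictPeriods_SL]
      simp
    | succ n => rw [PowerSeries.coeff_succ_X_mul, PowerSeries.coeff_mk]

lemma qExpansion_discriminant_mul_discInv : qExpansion 1 discriminant * discInv = PowerSeries.X := by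
  obtain ⟨u, hu0, hu, hv⟩ := exists_qExpansion_discriminant
  rw [hu, hv, mul_assoc, PowerSeries.mul_inv_cancel _ (by simp [hu0]), mul_one]

lemma constantCoeff_discInv : PowerSeries.constantCoeff discInv = 1 := by
  obtain ⟨u, hu0, -, hv⟩ := exists_qExpansion_discriminant
  simp [hv, hu0]

lemma euler_discInv : PowerSeries.euler discInv = (1 - e₂) * discInv := by
  have h1 := congrArg PowerSeries.euler qExpansion_discriminant_mul_discInv
  have hX : PowerSeries.euler PowerSeries.X = PowerSeries.X := by
    simp [PowerSeries.euler, Derivation.smul_apply]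
  rw [Derivation.leibniz, hX, euler_qExpansion_discriminant, smul_eq_mul, smul_eq_mul] at h1
  have h2 := qExpansion_discriminant_mul_discInv
  have h3 : qExpansion 1 discriminant * (PowerSeries.euler discInv - (1 - e₂) * discInv) = 0 := by
    linear_combination h1 - h2
  rcases mul_eq_zero.1 h3 with h | h
  · rw [h, zero_mul] at h2
    exact absurd h2.symm PowerSeries.X_ne_zero
  · exact sub_eq_zero.1 h

lemma coeff_discInv_pos (n : ℕ) : 0 < PowerSeries.coeff n discInv := by
  refine PowerSeries.coeff_pos_of_euler_eq euler_discInv constantCoeff_discInv ?_ (fun n hn => ?_) n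
  · simp [e₂, ← PowerSeries.coeff_zero_eq_constantCoeff_apply,
      -PowerSeries.coeff_zero_eq_constantCoeff]
  · have h : (0 : ℂ) < σ 1 n := by
      exact_mod_cast ArithmeticFunction.sigma_pos 1 n hn
    rw [map_sub, PowerSeries.coeff_one, if_neg hn, e₂, PowerSeries.coeff_mk, if_neg hn]
    have : (0 : ℂ) - -24 * (σ 1 n : ℂ) = 24 * σ 1 n := by ring
    rw [this]
    exact mul_pos (by norm_num) h

lemma coeff_E₄_pos (n : ℕ) : 0 < PowerSeries.coeff n (qExpansion 1 E₄) := by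
  rw [E_qExpansion_coeff _ ⟨2, rfl⟩]
  split_ifs with hn
  · exact one_pos
  · have h : (0 : ℂ) < σ 3 n := by
      exact_mod_cast ArithmeticFunction.sigma_pos 3 n hn
    have h4 : bernoulli 4 = -1 / 30 := by decide +kernel
    rw [h4]
    have : -(2 * ((4 : ℕ) : ℂ) / ((-1 / 30 : ℚ) : ℂ)) = 240 := by norm_num
    rw [this]
    exact mul_pos (by norm_num) h

lemma constantCoeff_E₄ : PowerSeries.constantCoeff (qExpansion 1 E₄) = 1 := by
  rw [← PowerSeries.coeff_zero_eq_constantCoeff_apply]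
  exact E_qExpansion_coeff_zero _ ⟨2, rfl⟩

lemma constantCoeff_E₆ : PowerSeries.constantCoeff (qExpansion 1 E₆) = 1 := by
  rw [← PowerSeries.coeff_zero_eq_constantCoeff_apply]
  exact E_qExpansion_coeff_zero _ ⟨3, rfl⟩

/-- The monomial `E₄ ^ i * E₆ ^ j`. -/
def eisensteinMonomial (i j : ℕ) : ModularForm 𝒮ℒ (4 * i + 6 * j) :=
  ((E₄.pow i).mul (E₆.pow j)).mcast (by ring)

lemma qExpansion_eisensteinMonomial (i j : ℕ) :
    qExpansion 1 (eisensteinMonomial i j) = qExpansion 1 E₄ ^ i * qExpansion 1 E₆ ^ j := by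
  rw [eisensteinMonomial, ModularForm.qExpansion_mcast,
    ModularForm.qExpansion_mul one_pos one_mem_strictPeriods_SL,
    ModularForm.qExpansion_pow one_pos one_mem_strictPeriods_SL,
    ModularForm.qExpansion_pow one_pos one_mem_strictPeriods_SL]

/-- For `G` of weight `12 r + 2` and level one, the constant term of `G / Δ ^ r` vanishes (the
residue theorem for the differential `G / Δ ^ r dz`). -/
theorem coeff_qExpansion_mul_discInv_pow (r : ℕ) {k : ℤ} (hk : k = 12 * r + 2)
    (G : ModularForm 𝒮ℒ k) : PowerSeries.coeff r (qExpansion 1 G * discInv ^ r) = 0 := by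
  induction r generalizing k with
  | zero =>
    obtain rfl : k = 2 := by simpa using hk
    have : G = 0 := rank_zero_iff_forall_zero.mp levelOne_weight_two_rank_zero G
    rw [this]
    simp [qExpansion_zero]
  | succ r ih =>
    set c := PowerSeries.coeff 0 (qExpansion 1 G) with hc
    set H : ModularForm 𝒮ℒ k := (eisensteinMonomial (3 * r + 2) 1).mcast
      (by rw [hk]; push_cast; ring) with hH
    have hHq : qExpansion 1 H = qExpansion 1 E₄ ^ (3 * r + 2) * qExpansion 1 E₆ := by
      rw [hH, ModularForm.qExpansion_mcast, qExpansion_eisensteinMonomial, pow_one]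
    obtain ⟨K, hK⟩ : ∃ K : ModularForm 𝒮ℒ k, (K : ℍ → ℂ) = G - c • ⇑H := ⟨G - c • H, rfl⟩
    have hdiff : qExpansion 1 K = qExpansion 1 G - c • qExpansion 1 H := by
      rw [hK, ← ModularForm.qExpansion_smul one_pos one_mem_strictPeriods_SL c H]
      exact ModularForm.qExpansion_sub one_pos one_mem_strictPeriods_SL G (c • H)
    have h0 : PowerSeries.coeff 0 (qExpansion 1 K) = 0 := by
      rw [hdiff, map_sub, PowerSeries.coeff_smul, ← hc, hHq]
      simp [constantCoeff_E₄, constantCoeff_E₆]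
    have h1 := qExpansion_eq_qExpansion_discriminant_mul K h0
    set G' := CuspForm.discriminantEquiv (toCuspForm K h0)
    have h2 : qExpansion 1 G = c • (qExpansion 1 E₄ ^ (3 * r + 2) * qExpansion 1 E₆) +
        qExpansion 1 discriminant * qExpansion 1 G' := by
      rw [← h1, hdiff, hHq, add_sub_cancel]
    have h3 := PowerSeries.coeff_ramanujan_exact euler_discInv euler_qExpansion_E₄
      (Nat.succ_ne_zero r)
    rw [show 3 * (r + 1) - 1 = 3 * r + 2 by omega] at h3
    have h4 : qExpansion 1 discriminant * qExpansion 1 G' * discInv ^ (r + 1) =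
        PowerSeries.X * (qExpansion 1 G' * discInv ^ r) := by
      rw [← qExpansion_discriminant_mul_discInv]; ring
    rw [h2, add_mul, map_add, h4, PowerSeries.coeff_succ_X_mul,
      ih (by rw [hk]; push_cast; ring) G', smul_mul_assoc, PowerSeries.coeff_smul, h3]
    simp

/-- Siegel's theorem on extremal modular forms: a level one form of weight `k > 0` cannot have a
`q`-expansion of the form `1 + O(q ^ (k / 12 + 2))`. -/
theorem exists_coeff_ne_zero {k : ℕ} (hk : k ≠ 0) (hk2 : Even k) (g : ModularForm 𝒮ℒ k)
    (h0 : PowerSeries.coeff 0 (qExpansion 1 g) = 1) :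
    ∃ m, m ≠ 0 ∧ m ≤ k / 12 + 1 ∧ PowerSeries.coeff m (qExpansion 1 g) ≠ 0 := by
  by_contra! hcon
  obtain ⟨i, j, r, hr, hw, hj⟩ : ∃ i j r : ℕ, r ≤ k / 12 + 1 ∧ k + (4 * i + 6 * j) = 12 * r + 2 ∧
      (j = 0 ∨ j = 1 ∧ r ≠ 0 ∧ i + 1 ≠ 3 * r) := by
    obtain ⟨m, rfl⟩ := hk2
    obtain ⟨a, b, hb, rfl⟩ : ∃ a b, b < 6 ∧ m = 6 * a + b :=
      ⟨m / 6, m % 6, Nat.mod_lt _ (by norm_num), by omega⟩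
    interval_cases b
    · exact ⟨2, 1, a + 1, by omega, by omega, by omega⟩
    · exact ⟨0, 0, a, by omega, by omega, by omega⟩
    · exact ⟨1, 1, a + 1, by omega, by omega, by omega⟩
    · exact ⟨2, 0, a + 1, by omega, by omega, by omega⟩
    · exact ⟨0, 1, a + 1, by omega, by omega, by omega⟩
    · exact ⟨1, 0, a + 1, by omega, by omega, by omega⟩
  have h1 := coeff_qExpansion_mul_discInv_pow r (by exact_mod_cast hw)
    (g.mul (eisensteinMonomial i j))
  rw [ModularForm.qExpansion_mul one_pos one_mem_strictPeriods_SL, qExpansion_eisensteinMonomial,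
    mul_assoc, PowerSeries.coeff_mul,
    Finset.sum_eq_single (0, r)] at h1
  · rw [h0, one_mul] at h1
    rcases hj with rfl | ⟨rfl, hr0, hir⟩
    · rw [pow_zero, mul_one] at h1
      exact PowerSeries.coeff_ramanujan_even_ne_zero constantCoeff_discInv coeff_discInv_pos
        constantCoeff_E₄ coeff_E₄_pos i r h1
    · rw [pow_one] at h1
      exact PowerSeries.coeff_ramanujan_odd_ne_zero euler_discInv euler_qExpansion_E₄
        constantCoeff_discInv coeff_discInv_pos constantCoeff_E₄ coeff_E₄_pos hr0 hir h1
  · intro x hx hne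
    have hx' := Finset.HasAntidiagonal.mem_antidiagonal.1 hx
    have hx1 : x.1 ≠ 0 := fun h => hne (Prod.ext h (by simpa [h] using hx'))
    rw [hcon x.1 hx1 (by omega), zero_mul]
  · intro h
    exact absurd (Finset.HasAntidiagonal.mem_antidiagonal.2 (by simp)) h

end LevelOne
end

noncomputable section

namespace TorusFourier

open MeasureTheory Complex
open scoped Real

/-- The mean of a function of two real variables over the unit square. -/
def torusMean (F : ℝ → ℝ → ℂ) : ℂ := ∫ x in (0 : ℝ)..1, ∫ y in (0 : ℝ)..1, F x y

lemma torusMean_const_mul (c : ℂ) (F : ℝ → ℝ → ℂ) :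
    torusMean (fun x y => c * F x y) = c * torusMean F := by
  simp [torusMean, intervalIntegral.integral_const_mul]

lemma torusMean_mul (f g : ℝ → ℂ) :
    torusMean (fun x y => f x * g y) = (∫ x in (0 : ℝ)..1, f x) * ∫ y in (0 : ℝ)..1, g y := by
  simp [torusMean, intervalIntegral.integral_const_mul, intervalIntegral.integral_mul_const]

lemma integrable_of_continuous {F : ℝ → ℝ → ℂ} (hF : Continuous (Function.uncurry F)) :
    Integrable (Function.uncurry F)
      ((volume.restrict (Set.Ioc (0 : ℝ) 1)).prod (volume.restrict (Set.Ioc (0 : ℝ) 1))) := by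
  rw [Measure.prod_restrict]
  exact (hF.continuousOn.integrableOn_compact
    ((isCompact_Icc (a := (0 : ℝ)) (b := 1)).prod (isCompact_Icc (a := (0 : ℝ)) (b := 1)))).mono_set
    (Set.prod_mono Set.Ioc_subset_Icc_self Set.Ioc_subset_Icc_self)

lemma torusMean_swap {F : ℝ → ℝ → ℂ} (hF : Continuous (Function.uncurry F)) :
    torusMean (fun x y => F y x) = torusMean F := by
  simp only [torusMean, intervalIntegral.integral_of_le zero_le_one]
  exact (integral_integral_swap (integrable_of_continuous hF)).symm

lemma torusMean_add {F G : ℝ → ℝ → ℂ} (hF : Continuous (Function.uncurry F))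
    (hG : Continuous (Function.uncurry G)) :
    torusMean (fun x y => F x y + G x y) = torusMean F + torusMean G := by
  have h : ∀ {F : ℝ → ℝ → ℂ}, Continuous (Function.uncurry F) → ∀ x, Continuous (F x) :=
    fun hF x => hF.comp (Continuous.prodMk_right x)
  rw [torusMean, torusMean, torusMean, ← intervalIntegral.integral_add
    (intervalIntegral.continuous_parametric_intervalIntegral_of_continuous' hF 0 1
      |>.intervalIntegrable _ _)
    (intervalIntegral.continuous_parametric_intervalIntegral_of_continuous' hG 0 1
      |>.intervalIntegrable _ _)]
  refine intervalIntegral.integral_congr fun x _ => ?_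
  exact intervalIntegral.integral_add ((h hF x).intervalIntegrable _ _)
    ((h hG x).intervalIntegrable _ _)

lemma norm_torusMean_le {F : ℝ → ℝ → ℂ} {C : ℝ}
    (hC : ∀ x ∈ Set.Icc (0 : ℝ) 1, ∀ y ∈ Set.Icc (0 : ℝ) 1, ‖F x y‖ ≤ C) : ‖torusMean F‖ ≤ C := by
  have hmem : ∀ x ∈ Set.uIoc (0 : ℝ) 1, x ∈ Set.Icc (0 : ℝ) 1 := fun x hx => by
    rw [Set.uIoc_of_le zero_le_one] at hx
    exact Set.Ioc_subset_Icc_self hx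
  have := intervalIntegral.norm_integral_le_of_norm_le_const (a := 0) (b := 1) (C := C)
    (f := fun x => ∫ y in (0 : ℝ)..1, F x y) fun x hx => by
      have := intervalIntegral.norm_integral_le_of_norm_le_const (a := 0) (b := 1) (C := C)
        (f := F x) fun y hy => hC x (hmem x hx) y (hmem y hy)
      simpa using this
  simpa [torusMean] using this

lemma torusMean_neg_right {F : ℝ → ℝ → ℂ} (hy : ∀ x y, F x (y + 1) = F x y) :
    torusMean (fun x y => F x (-y)) = torusMean F := by
  unfold torusMean
  congr 1
  ext x
  have := Function.Periodic.intervalIntegral_add_eq (f := F x) (T := 1) (hy x) (-1) 0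
  simpa using this

lemma torusMean_shear_right {F : ℝ → ℝ → ℂ} (hy : ∀ x y, F x (y + 1) = F x y) :
    torusMean (fun x y => F x (y - x)) = torusMean F := by
  unfold torusMean
  congr 1
  ext x
  have := Function.Periodic.intervalIntegral_add_eq (f := F x) (T := 1) (hy x) (-x) 0
  rw [intervalIntegral.integral_comp_sub_right (F x) x]
  simpa [sub_eq_add_neg, add_comm] using this

lemma torusMean_shear_left {F : ℝ → ℝ → ℂ} (hF : Continuous (Function.uncurry F))
    (hx : ∀ x y, F (x + 1) y = F x y) :
    torusMean (fun x y => F (x - y) y) = torusMean F := by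
  have hF' : Continuous (Function.uncurry fun x y => F y x) := hF.comp continuous_swap
  have hF'' : Continuous (Function.uncurry fun x y => F (x - y) y) :=
    hF.comp (by fun_prop : Continuous fun p : ℝ × ℝ => (p.1 - p.2, p.2))
  rw [← torusMean_swap hF'', ← torusMean_swap hF,
    ← torusMean_shear_right (F := fun x y => F y x) (fun x y => hx y x)]

/-- The character `exp (2 π i w)`. -/
def ef (w : ℂ) : ℂ := exp (2 * π * I * w)

lemma ef_add (v w : ℂ) : ef (v + w) = ef v * ef w := by rw [ef, ef, ef, ← exp_add]; ring_nf

lemma ef_int (n : ℤ) : ef n = 1 := by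
  rw [ef, mul_comm, exp_int_mul_two_pi_mul_I]

lemma ef_zero : ef 0 = 1 := by simp [ef]

lemma norm_ef (w : ℂ) : ‖ef w‖ = Real.exp (-(2 * π * w.im)) := by
  rw [ef, norm_exp]
  simp

lemma differentiable_ef : Differentiable ℂ ef := by unfold ef; fun_prop

lemma continuous_ef : Continuous ef := differentiable_ef.continuous

lemma integral_ef_eq_zero {m : ℤ} (hm : m ≠ 0) : ∫ x in (0 : ℝ)..1, ef (m * x) = 0 := by
  have hc : (2 * π * I * m : ℂ) ≠ 0 := by
    have : (m : ℂ) ≠ 0 := by exact_mod_cast hm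
    simp [Real.pi_ne_zero, this]
  have h : ∀ x : ℝ, ef (m * x) = exp ((2 * π * I * m : ℂ) * x) := fun x => by rw [ef]; ring_nf
  simp only [h]
  rw [integral_exp_mul_complex hc]
  have h1 : exp ((2 * π * I * m : ℂ) * (1 : ℝ)) = 1 := by
    have := ef_int m
    rw [ef] at this
    simpa using this
  rw [h1]
  simp

/-- A continuous doubly periodic function with summable Fourier coefficients is the sum of its
Fourier series. -/
theorem hasSum_fourier {F : ℝ → ℝ → ℂ} (hF : Continuous (Function.uncurry F))
    (hx : ∀ x y, F (x + 1) y = F x y) (hy : ∀ x y, F x (y + 1) = F x y)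
    (hs : Summable fun p : ℤ × ℤ => torusMean fun x y => ef (-(p.1 * x + p.2 * y)) * F x y)
    (x y : ℝ) :
    HasSum (fun p : ℤ × ℤ => (torusMean fun x y => ef (-(p.1 * x + p.2 * y)) * F x y) *
      ef (p.1 * x + p.2 * y)) (F x y) := by
  let π' : C(Fin 2 → ℝ, UnitAddTorus (Fin 2)) :=
    ⟨Pi.map fun _ (t : ℝ) => (t : UnitAddCircle), by fun_prop⟩
  have hq : Topology.IsQuotientMap π' :=
    (IsOpenQuotientMap.piMap fun _ : Fin 2 =>
      (QuotientAddGroup.isOpenQuotientMap_mk :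
        IsOpenQuotientMap ((↑) : ℝ → UnitAddCircle))).isQuotientMap
  let F' : C(Fin 2 → ℝ, ℂ) := ⟨fun v => F (v 0) (v 1),
    hF.comp (by fun_prop : Continuous fun v : Fin 2 → ℝ => (v 0, v 1))⟩
  have hfac : Function.FactorsThrough F' π' := by
    intro v v' h
    have h0 := congrFun h 0
    have h1 := congrFun h 1
    have hper : ∀ (f : ℝ → ℂ), (∀ t, f (t + 1) = f t) → ∀ t t' : ℝ,
        (t : UnitAddCircle) = t' → f t = f t' := by
      intro f hf t t' htt
      have hp : Function.Periodic f 1 := hf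
      rw [← hp.lift_coe t, ← hp.lift_coe t', htt]
    change F (v 0) (v 1) = F (v' 0) (v' 1)
    rw [hper (fun t => F t (v 1)) (fun t => hx t _) _ _ h0,
      hper (fun t => F (v' 0) t) (fun t => hy _ t) _ _ h1]
  let f : C(UnitAddTorus (Fin 2), ℂ) := hq.lift F' hfac
  have hf : ∀ v, f (π' v) = F' v := fun v => by
    have := ContinuousMap.congr_fun (hq.lift_comp F' hfac) v
    exact this
  have hmono : ∀ (n : Fin 2 → ℤ) (v : Fin 2 → ℝ),
      UnitAddTorus.mFourier n (π' v) = ef (n 0 * v 0 + n 1 * v 1) := by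
    intro n v
    change ∏ i, fourier (n i) ((v i : ℝ) : UnitAddCircle) = _
    simp only [fourier_coe_apply, Fin.prod_univ_two, ef, ← exp_add]
    congr 1
    push_cast
    ring
  have hcoef : ∀ n : Fin 2 → ℤ, UnitAddTorus.mFourierCoeff f n =
      torusMean fun x y => ef (-(n 0 * x + n 1 * y)) * F x y := by
    intro n
    rw [UnitAddTorus.mFourierCoeff_eq_integral f n 0]
    have hset : {v : Fin 2 → ℝ | ∀ i, v i ∈ Set.Ioc ((0 : Fin 2 → ℝ) i) ((0 : Fin 2 → ℝ) i + 1)} =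
        MeasurableEquiv.finTwoArrow ⁻¹' (Set.Ioc (0 : ℝ) 1 ×ˢ Set.Ioc (0 : ℝ) 1) := by
      ext v
      simp [Fin.forall_fin_two]
    have hint : ∀ v : Fin 2 → ℝ,
        UnitAddTorus.mFourier (-n) (fun i => (v i : UnitAddCircle)) •
          f (fun i => (v i : UnitAddCircle)) =
        (fun p : ℝ × ℝ => ef (-(n 0 * p.1 + n 1 * p.2)) * F p.1 p.2)
          (MeasurableEquiv.finTwoArrow v) := by
      intro v
      change UnitAddTorus.mFourier (-n) (π' v) • f (π' v) = _
      rw [hmono, hf]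
      simp only [Pi.neg_apply, Int.cast_neg, smul_eq_mul]
      congr 2
      simp [MeasurableEquiv.finTwoArrow]
      ring
    rw [hset]
    simp_rw [hint]
    rw [(volume_preserving_finTwoArrow ℝ).setIntegral_preimage_emb
      (MeasurableEquiv.measurableEmbedding _)
      (fun p : ℝ × ℝ => ef (-(n 0 * p.1 + n 1 * p.2)) * F p.1 p.2)]
    have hcont : Continuous (Function.uncurry fun x y : ℝ =>
        ef (-(n 0 * x + n 1 * y)) * F x y) := by
      refine Continuous.mul ?_ hF
      exact continuous_ef.comp (by fun_prop)
    have hI := integrable_of_continuous hcont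
    rw [Measure.prod_restrict] at hI
    rw [Measure.volume_eq_prod]
    refine (setIntegral_prod _ hI).trans ?_
    simp only [torusMean, intervalIntegral.integral_of_le zero_le_one]
    rfl
  let e : (Fin 2 → ℤ) ≃ ℤ × ℤ := finTwoArrowEquiv ℤ
  have hsum : Summable (UnitAddTorus.mFourierCoeff f) := by
    refine (e.summable_iff.2 hs).congr fun n => ?_
    rw [hcoef]
    rfl
  have h := UnitAddTorus.hasSum_mFourier_series_apply_of_summable hsum (π' ![x, y])
  rw [hf] at h
  rw [← e.hasSum_iff]
  refine h.congr_fun fun n => ?_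
  rw [hcoef, hmono]
  rfl

end TorusFourier
end

noncomputable section

namespace TorusFourier

open Complex

lemma integral_eq_of_periodic {h : ℂ → ℂ} {α α' : ℝ}
    (hd : ∀ z : ℂ, z.im ∈ Set.uIcc α α' → DifferentiableAt ℂ h z)
    (hp : ∀ z : ℂ, z.im ∈ Set.uIcc α α' → h (z + 1) = h z) :
    ∫ x in (0 : ℝ)..1, h (x + α * I) = ∫ x in (0 : ℝ)..1, h (x + α' * I) := by
  have h1 := integral_boundary_rect_eq_zero_of_differentiableOn h (α * I) (1 + α' * I)
    (fun z hz => (hd z (by simpa using hz.2)).differentiableWithinAt)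
  have h2 : ∫ y in α..α', h (1 + y * I) = ∫ y in α..α', h (0 + y * I) := by
    refine intervalIntegral.integral_congr fun y hy => ?_
    rw [zero_add, add_comm, hp _ (by simpa using hy)]
  simp only [mul_im, ofReal_re, I_im, mul_one, ofReal_im, I_re, mul_zero, add_zero, mul_re,
    sub_self, add_im, one_im, zero_add, add_re, one_re, ofReal_one, ofReal_zero] at h1 h2
  rw [h2, add_sub_cancel_right] at h1
  exact sub_eq_zero.1 h1

end TorusFourier

namespace GoldenHilbert

open Complex TorusFourier
open UpperHalfPlane hiding I

/-- `(√5 - 1) / 2`. -/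
def t₁ : ℝ := (-1 + √5) / 2

/-- `-(√5 + 1) / 2`. -/
def t₂ : ℝ := (-1 - √5) / 2

lemma t₁_add_t₂ : t₁ + t₂ = -1 := by unfold t₁ t₂; ring

lemma t₁_mul_t₂ : t₁ * t₂ = -1 := by
  have h : √5 * √5 = (5 : ℝ) := Real.mul_self_sqrt (by norm_num)
  unfold t₁ t₂; linarith

lemma t₁_sq : t₁ ^ 2 = 1 - t₁ := by linear_combination t₁ * t₁_add_t₂ - t₁_mul_t₂

lemma t₂_sq : t₂ ^ 2 = 1 - t₂ := by linear_combination t₂ * t₁_add_t₂ - t₁_mul_t₂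

lemma t₁_bounds : 0.618 < t₁ ∧ t₁ < 0.6181 := by
  have h1 : (2.236 : ℝ) < √5 := Real.lt_sqrt_of_sq_lt (by norm_num)
  have h2 : √5 < (2.2361 : ℝ) := (Real.sqrt_lt' (by norm_num)).2 (by norm_num)
  unfold t₁
  constructor <;> linarith

lemma t₂_eq : t₂ = -1 - t₁ := by linear_combination t₁_add_t₂

lemma sigma₁_mk (x y : ℤ) : sigma₁ ⟨x, y⟩ = x + y * t₁ := by
  simp [sigma₁, QuadraticAlgebra.lift, t₁]

lemma sigma₂_mk (x y : ℤ) : sigma₂ ⟨x, y⟩ = x + y * t₂ := by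
  simp [sigma₂, QuadraticAlgebra.lift, t₂]

lemma sigma₁_vartheta : sigma₁ vartheta = t₁ := by simp [vartheta, sigma₁_mk]

lemma sigma₂_vartheta : sigma₂ vartheta = t₂ := by simp [vartheta, sigma₂_mk]

lemma eta_eq : eta = ⟨3, 1⟩ := by decide

lemma sigma₁_eta : sigma₁ eta = 3 + t₁ := by simp [eta_eq, sigma₁_mk]

lemma sigma₂_eta : sigma₂ eta = 3 + t₂ := by simp [eta_eq, sigma₂_mk]

lemma three_add_t₁_pos : 0 < 3 + t₁ := by linarith [t₁_bounds.1]

lemma three_add_t₂_pos : 0 < 3 + t₂ := by linarith [t₁_bounds.2, t₂_eq]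

lemma eta_norm : (3 + t₁) * (3 + t₂) = 5 := by
  linear_combination 3 * t₁_add_t₂ + t₁_mul_t₂

lemma sigma₁_div (x y : ℤ) : sigma₁ ⟨x, y⟩ / sigma₁ eta = (x + y * t₁) * (3 + t₂) / 5 := by
  rw [sigma₁_mk, sigma₁_eta, div_eq_div_iff three_add_t₁_pos.ne' (by norm_num)]
  linear_combination (-(x + y * t₁)) * eta_norm

lemma sigma₂_div (x y : ℤ) : sigma₂ ⟨x, y⟩ / sigma₂ eta = (x + y * t₂) * (3 + t₁) / 5 := by
  rw [sigma₂_mk, sigma₂_eta, div_eq_div_iff three_add_t₂_pos.ne' (by norm_num)]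
  linear_combination (-(x + y * t₂)) * eta_norm

lemma traceEtaInv_mk (x y : ℤ) : traceEtaInv ⟨x, y⟩ = x - y := by
  rw [traceEtaInv, sigma₁_div, sigma₂_div]
  linear_combination ((x + 3 * y) * t₁_add_t₂ + 2 * y * t₁_mul_t₂) / 5

lemma trace_mk (x y : ℤ) : trace ⟨x, y⟩ = 2 * x - y := by
  rw [trace, sigma₁_mk, sigma₂_mk]
  linear_combination y * t₁_add_t₂

/-- The heights `(α, β)` such that `α + β ϑ` is totally positive. -/
def PosCone (α β : ℝ) : Prop := 0 < α + β * t₁ ∧ 0 < α + β * t₂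

lemma posCone_one_zero {α : ℝ} (h : 0 < α) : PosCone α 0 := by simp [PosCone, h]

lemma PosCone.mem_left {α α' β c : ℝ} (h : PosCone α β) (h' : PosCone α' β)
    (hc : c ∈ Set.uIcc α α') : PosCone c β := by
  rcases Set.mem_uIcc.1 hc with hc | hc
  · exact ⟨by linarith [h.1, hc.1], by linarith [h.2, hc.1]⟩
  · exact ⟨by linarith [h'.1, hc.1], by linarith [h'.2, hc.1]⟩

lemma PosCone.mem_right {α β β' c : ℝ} (h : PosCone α β) (h' : PosCone α β')
    (hc : c ∈ Set.uIcc β β') : PosCone α c := by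
  have h1 : 0 < t₁ := by linarith [t₁_bounds.1]
  have h2 : t₂ < 0 := by linarith [t₂_eq]
  rcases Set.mem_uIcc.1 hc with hc | hc
  · exact ⟨by nlinarith [h.1, hc.1], by nlinarith [h'.2, hc.2]⟩
  · exact ⟨by nlinarith [h'.1, hc.1], by nlinarith [h.2, hc.2]⟩

/-- A function on the tube over `PosCone` which is holomorphic and invariant under translation by
the integers in each variable. -/
structure PeriodicOnTube (Φ : ℂ → ℂ → ℂ) : Prop where
  differentiableAt : ∀ a b : ℂ, PosCone a.im b.im → DifferentiableAt ℂ (Function.uncurry Φ) (a, b)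
  left : ∀ a b : ℂ, PosCone a.im b.im → Φ (a + 1) b = Φ a b
  right : ∀ a b : ℂ, PosCone a.im b.im → Φ a (b + 1) = Φ a b

/-- The restriction of `Φ` to a fixed height. -/
def atHeight (Φ : ℂ → ℂ → ℂ) (α β : ℝ) (x y : ℝ) : ℂ := Φ (x + α * I) (y + β * I)

lemma im_add_mul_I (x α : ℝ) : ((x : ℂ) + α * I).im = α := by simp

namespace PeriodicOnTube

variable {Φ : ℂ → ℂ → ℂ} {α β α' β' : ℝ}

lemma continuous (h : PeriodicOnTube Φ) (hQ : PosCone α β) :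
    Continuous (Function.uncurry (atHeight Φ α β)) := by
  rw [continuous_iff_continuousAt]
  rintro ⟨x, y⟩
  have h1 : ContinuousAt (Function.uncurry Φ) ((x : ℂ) + α * I, (y : ℂ) + β * I) :=
    (h.differentiableAt _ _ (by simpa using hQ)).continuousAt
  exact ContinuousAt.comp (f := fun p : ℝ × ℝ => ((p.1 : ℂ) + α * I, (p.2 : ℂ) + β * I))
    (x := (x, y)) h1 (by fun_prop)

lemma atHeight_left (h : PeriodicOnTube Φ) (hQ : PosCone α β) (x y : ℝ) :
    atHeight Φ α β (x + 1) y = atHeight Φ α β x y := by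
  rw [atHeight, atHeight, ← h.left (x + α * I) (y + β * I) (by simpa using hQ)]
  congr 1; push_cast; ring

lemma atHeight_right (h : PeriodicOnTube Φ) (hQ : PosCone α β) (x y : ℝ) :
    atHeight Φ α β x (y + 1) = atHeight Φ α β x y := by
  rw [atHeight, atHeight, ← h.right (x + α * I) (y + β * I) (by simpa using hQ)]
  congr 1; push_cast; ring

lemma torusMean_left (h : PeriodicOnTube Φ) (hQ : PosCone α β) (hQ' : PosCone α' β) :
    torusMean (atHeight Φ α β) = torusMean (atHeight Φ α' β) := by
  rw [← torusMean_swap (h.continuous hQ), ← torusMean_swap (h.continuous hQ')]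
  unfold torusMean
  refine intervalIntegral.integral_congr fun y _ => ?_
  refine integral_eq_of_periodic (h := fun a => Φ a (y + β * I)) (fun z hz => ?_) (fun z hz => ?_)
  · have := h.differentiableAt z (y + β * I) (by simpa using hQ.mem_left hQ' hz)
    exact DifferentiableAt.comp (f := fun a : ℂ => (a, (y : ℂ) + β * I)) z this (by fun_prop)
  · exact h.left _ _ (by simpa using hQ.mem_left hQ' hz)

lemma torusMean_right (h : PeriodicOnTube Φ) (hQ : PosCone α β) (hQ' : PosCone α β') :
    torusMean (atHeight Φ α β) = torusMean (atHeight Φ α β') := by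
  unfold torusMean
  refine intervalIntegral.integral_congr fun x _ => ?_
  refine integral_eq_of_periodic (h := fun b => Φ (x + α * I) b) (fun z hz => ?_) (fun z hz => ?_)
  · have := h.differentiableAt (x + α * I) z (by simpa using hQ.mem_right hQ' hz)
    exact DifferentiableAt.comp (f := fun b : ℂ => ((x : ℂ) + α * I, b)) z this (by fun_prop)
  · exact h.right _ _ (by simpa using hQ.mem_right hQ' hz)

/-- The mean over the torus does not depend on the height. -/
lemma torusMean_eq (h : PeriodicOnTube Φ) (hQ : PosCone α β) :
    torusMean (atHeight Φ α β) = torusMean (atHeight Φ 1 0) := by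
  obtain ⟨A, hA0, hA⟩ : ∃ A : ℝ, 0 < A ∧ PosCone A β := by
    refine ⟨1 + |β * t₁| + |β * t₂|, by positivity, ?_, ?_⟩
    · linarith [neg_abs_le (β * t₁), abs_nonneg (β * t₂)]
    · linarith [neg_abs_le (β * t₂), abs_nonneg (β * t₁)]
  rw [h.torusMean_left hQ hA, h.torusMean_right hA (posCone_one_zero hA0),
    h.torusMean_left (posCone_one_zero hA0) (posCone_one_zero one_pos)]

lemma mul {Ψ : ℂ → ℂ → ℂ} (h : PeriodicOnTube Φ) (h' : PeriodicOnTube Ψ) :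
    PeriodicOnTube (fun a b => Φ a b * Ψ a b) where
  differentiableAt a b hQ := (h.differentiableAt a b hQ).mul (h'.differentiableAt a b hQ)
  left a b hQ := by rw [h.left a b hQ, h'.left a b hQ]
  right a b hQ := by rw [h.right a b hQ, h'.right a b hQ]

end PeriodicOnTube

lemma periodicOnTube_ef (m n : ℤ) : PeriodicOnTube (fun a b => ef (-(m * a + n * b))) where
  differentiableAt a b _ := by
    have : Differentiable ℂ (fun p : ℂ × ℂ => ef (-(m * p.1 + n * p.2))) :=
      differentiable_ef.comp (by fun_prop)
    exact this (a, b)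
  left a b _ := by
    have : -((m : ℂ) * (a + 1) + n * b) = -(m * a + n * b) + ((-m : ℤ) : ℂ) := by
      push_cast; ring
    rw [this, ef_add, ef_int, mul_one]
  right a b _ := by
    have : -((m : ℂ) * a + n * (b + 1)) = -(m * a + n * b) + ((-n : ℤ) : ℂ) := by
      push_cast; ring
    rw [this, ef_add, ef_int, mul_one]

end GoldenHilbert
end

noncomputable section

namespace GoldenHilbert

open Complex TorusFourier
open UpperHalfPlane hiding I

/-- The function `f` in the coordinates `z₁ = a + b ϑ`, `z₂ = a + b ϑ'`. -/
def cover (f : ℍ × ℍ → ℂ) (a b : ℂ) : ℂ := f (ofComplex (a + b * t₁), ofComplex (a + b * t₂))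

lemma im_add_mul_ofReal (a b : ℂ) (t : ℝ) : (a + b * t).im = a.im + b.im * t := by simp

lemma coe_act_fst (M : Matrix.SpecialLinearGroup (Fin 2) R) (z : ℍ × ℍ) :
    ((act M z).1 : ℂ) = (sigma₁ (M 0 0) * z.1 + sigma₁ (M 0 1)) /
      (sigma₁ (M 1 0) * z.1 + sigma₁ (M 1 1)) := by
  rw [act, coe_specialLinearGroup_apply]
  simp

lemma coe_act_snd (M : Matrix.SpecialLinearGroup (Fin 2) R) (z : ℍ × ℍ) :
    ((act M z).2 : ℂ) = (sigma₂ (M 0 0) * z.2 + sigma₂ (M 0 1)) /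
      (sigma₂ (M 1 0) * z.2 + sigma₂ (M 1 1)) := by
  rw [act, coe_specialLinearGroup_apply]
  simp

lemma act_mul (M N : Matrix.SpecialLinearGroup (Fin 2) R) (z : ℍ × ℍ) :
    act (M * N) z = act M (act N z) := by
  simp [act, mul_smul]

/-- The translation by an element of `R`. -/
def translation (X : R) : Matrix.SpecialLinearGroup (Fin 2) R :=
  ⟨!![1, X; 0, 1], by simp [Matrix.det_fin_two]⟩

/-- The diagonal matrix of a unit and its inverse. -/
def diagonal (u : Rˣ) : Matrix.SpecialLinearGroup (Fin 2) R :=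
  ⟨!![(u : R), 0; 0, ((u⁻¹ : Rˣ) : R)], by simp [Matrix.det_fin_two]⟩

/-- The matrix of `z ↦ -1 / z`. -/
def inversion : Matrix.SpecialLinearGroup (Fin 2) R :=
  ⟨!![0, -1; 1, 0], by simp [Matrix.det_fin_two]⟩

lemma coe_act_translation (X : R) (z : ℍ × ℍ) :
    ((act (translation X) z).1 : ℂ) = z.1 + sigma₁ X ∧
      ((act (translation X) z).2 : ℂ) = z.2 + sigma₂ X := by
  rw [coe_act_fst, coe_act_snd]
  simp [translation]

lemma sigma₁_unit_mul_inv (u : Rˣ) : sigma₁ (u : R) * sigma₁ ((u⁻¹ : Rˣ) : R) = 1 := by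
  rw [← map_mul, Units.mul_inv, map_one]

lemma sigma₂_unit_mul_inv (u : Rˣ) : sigma₂ (u : R) * sigma₂ ((u⁻¹ : Rˣ) : R) = 1 := by
  rw [← map_mul, Units.mul_inv, map_one]

lemma coe_act_diagonal (u : Rˣ) (z : ℍ × ℍ) :
    ((act (diagonal u) z).1 : ℂ) = (sigma₁ (u : R) : ℂ) ^ 2 * z.1 ∧
      ((act (diagonal u) z).2 : ℂ) = (sigma₂ (u : R) : ℂ) ^ 2 * z.2 := by
  have h1 : (sigma₁ (u : R) : ℂ) * sigma₁ ((u⁻¹ : Rˣ) : R) = 1 := by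
    exact_mod_cast sigma₁_unit_mul_inv u
  have h2 : (sigma₂ (u : R) : ℂ) * sigma₂ ((u⁻¹ : Rˣ) : R) = 1 := by
    exact_mod_cast sigma₂_unit_mul_inv u
  rw [coe_act_fst, coe_act_snd]
  have h1' := right_ne_zero_of_mul_eq_one h1
  have h2' := right_ne_zero_of_mul_eq_one h2
  simp only [diagonal, Matrix.SpecialLinearGroup.coe_mk, Matrix.of_apply, Matrix.cons_val', Matrix.cons_val_zero,
    Matrix.cons_val_one, Matrix.cons_val_fin_one, map_zero, ofReal_zero, zero_mul, add_zero, zero_add]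
  constructor
  · rw [div_eq_iff h1']; linear_combination (-(sigma₁ (u : R) : ℂ) * z.1) * h1
  · rw [div_eq_iff h2']; linear_combination (-(sigma₂ (u : R) : ℂ) * z.2) * h2

lemma coe_act_inversion (z : ℍ × ℍ) :
    ((act inversion z).1 : ℂ) = -1 / z.1 ∧ ((act inversion z).2 : ℂ) = -1 / z.2 := by
  rw [coe_act_fst, coe_act_snd]
  simp [inversion]

/-- `ϑ` as a unit. -/
def thetaUnit : Rˣ := ⟨vartheta, 1 + vartheta, by decide, by decide⟩

variable {w : ℕ} {f : ℍ × ℍ → ℂ}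

lemma IsHilbertModularForm.apply_translation (hf : IsHilbertModularForm w f) (X : R) (z : ℍ × ℍ) :
    f (act (translation X) z) = f z := by
  rw [hf.transform]
  simp [translation]

lemma IsHilbertModularForm.apply_diagonal_theta (hf : IsHilbertModularForm w f) (z : ℍ × ℍ) :
    f (act (diagonal thetaUnit) z) = (-1) ^ w * f z := by
  rw [hf.transform]
  have h : (1 + (t₁ : ℂ)) * (1 + t₂) = -1 := by
    have h1 : (t₁ : ℂ) + t₂ = -1 := by exact_mod_cast t₁_add_t₂
    have h2 : (t₁ : ℂ) * t₂ = -1 := by exact_mod_cast t₁_mul_t₂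
    linear_combination h1 + h2
  rw [← h]
  simp [diagonal, thetaUnit, sigma₁_vartheta, sigma₂_vartheta]

lemma cover_eq {a b : ℂ} (h : PosCone a.im b.im) :
    cover f a b = f (⟨a + b * t₁, by simpa using h.1⟩, ⟨a + b * t₂, by simpa using h.2⟩) := by
  rw [cover, ofComplex_apply_of_im_pos (by simpa using h.1),
    ofComplex_apply_of_im_pos (by simpa using h.2)]

lemma prod_ext {z z' : ℍ × ℍ} (h1 : (z.1 : ℂ) = z'.1) (h2 : (z.2 : ℂ) = z'.2) : z = z' :=
  Prod.ext (UpperHalfPlane.ext h1) (UpperHalfPlane.ext h2)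

lemma IsHilbertModularForm.periodicOnTube (hf : IsHilbertModularForm w f) :
    PeriodicOnTube (cover f) where
  differentiableAt a b hQ := by
    have hopen : IsOpen {p : ℂ × ℂ | 0 < p.1.im ∧ 0 < p.2.im} :=
      (isOpen_lt continuous_const (Complex.continuous_im.comp continuous_fst)).inter
        (isOpen_lt continuous_const (Complex.continuous_im.comp continuous_snd))
    have h1 := hf.holomorphic.differentiableAt (hopen.mem_nhds
      (show (a + b * t₁, a + b * t₂) ∈ {p : ℂ × ℂ | 0 < p.1.im ∧ 0 < p.2.im} by
        simpa using ⟨hQ.1, hQ.2⟩))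
    exact DifferentiableAt.comp (f := fun p : ℂ × ℂ => (p.1 + p.2 * (t₁ : ℂ), p.1 + p.2 * (t₂ : ℂ)))
      (a, b) h1 (by fun_prop)
  left a b hQ := by
    rw [cover_eq hQ, cover_eq (by simpa using hQ)]
    refine Eq.trans ?_ (hf.apply_translation 1 _)
    congr 1
    apply prod_ext
    · rw [(coe_act_translation _ _).1]; simp; ring
    · rw [(coe_act_translation _ _).2]; simp; ring
  right a b hQ := by
    rw [cover_eq hQ, cover_eq (by simpa using hQ)]
    refine Eq.trans ?_ (hf.apply_translation vartheta _)
    congr 1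
    apply prod_ext
    · rw [(coe_act_translation _ _).1, sigma₁_vartheta]; simp; ring
    · rw [(coe_act_translation _ _).2, sigma₂_vartheta]; simp; ring

lemma IsSymmetricHilbertModularForm.cover_conj (hf : IsSymmetricHilbertModularForm w f) (a b : ℂ) :
    cover f (a - b) (-b) = cover f a b := by
  rw [cover, cover, hf.symm]
  have h : (t₁ : ℂ) + t₂ = -1 := by exact_mod_cast t₁_add_t₂
  congr 3
  · linear_combination -b * h
  · linear_combination -b * h

lemma posCone_theta {α β : ℝ} (h : PosCone α β) : PosCone (α - β) (2 * β - α) := by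
  have h1 : (α - β) + (2 * β - α) * t₁ = (1 - t₁) * (α + β * t₁) := by
    linear_combination β * t₁_sq
  have h2 : (α - β) + (2 * β - α) * t₂ = (1 - t₂) * (α + β * t₂) := by
    linear_combination β * t₂_sq
  rw [PosCone, h1, h2]
  exact ⟨mul_pos (by linarith [t₁_bounds.2]) h.1,
    mul_pos (by linarith [t₁_bounds.1, t₂_eq]) h.2⟩

lemma IsHilbertModularForm.cover_theta (hf : IsHilbertModularForm w f) {a b : ℂ}
    (hQ : PosCone a.im b.im) : cover f (a - b) (2 * b - a) = (-1) ^ w * cover f a b := by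
  have h1 : (t₁ : ℂ) ^ 2 = 1 - t₁ := by exact_mod_cast t₁_sq
  have h2 : (t₂ : ℂ) ^ 2 = 1 - t₂ := by exact_mod_cast t₂_sq
  rw [cover_eq hQ, cover_eq (by simpa using posCone_theta hQ), ← hf.apply_diagonal_theta]
  congr 1
  apply prod_ext
  · rw [(coe_act_diagonal _ _).1]
    change _ = ((sigma₁ vartheta : ℝ) : ℂ) ^ 2 * (a + b * t₁)
    rw [sigma₁_vartheta]
    change a - b + (2 * b - a) * t₁ = _
    linear_combination (b - a - b * t₁) * h1
  · rw [(coe_act_diagonal _ _).2]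
    change _ = ((sigma₂ vartheta : ℝ) : ℂ) ^ 2 * (a + b * t₂)
    rw [sigma₂_vartheta]
    change a - b + (2 * b - a) * t₂ = _
    linear_combination (b - a - b * t₂) * h2

/-- The integrand of the Fourier coefficient with frequencies `m`, `n`. -/
def twist (f : ℍ × ℍ → ℂ) (m n : ℤ) (a b : ℂ) : ℂ := ef (-(m * a + n * b)) * cover f a b

/-- The Fourier coefficient with frequencies `m`, `n` in the coordinates of `cover`. -/
def coeffAt (f : ℍ × ℍ → ℂ) (m n : ℤ) : ℂ := torusMean (atHeight (twist f m n) 1 0)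

lemma hilbertCoeff_mk (f : ℍ × ℍ → ℂ) (x y : ℤ) :
    hilbertCoeff f ⟨x, y⟩ = coeffAt f (x - y) (2 * y - x) := by
  unfold hilbertCoeff coeffAt torusMean
  refine intervalIntegral.integral_congr fun u _ => intervalIntegral.integral_congr fun v _ => ?_
  have hQ : PosCone ((u : ℂ) + (1 : ℝ) * I).im ((v : ℂ) + (0 : ℝ) * I).im := by simp [PosCone]
  simp only [atHeight, twist]
  rw [cover_eq hQ, mul_comm, sigma₁_div, sigma₂_div]
  congr 1
  · rw [ef]
    congr 1
    simp only [coe_vadd, sigma₁_vartheta, sigma₂_vartheta, UpperHalfPlane.coe_I]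
    push_cast
    have h1 : (t₁ : ℂ) + t₂ = -1 := by exact_mod_cast t₁_add_t₂
    have h2 : (t₁ : ℂ) * t₂ = -1 := by exact_mod_cast t₁_mul_t₂
    have h3 : (t₁ : ℂ) ^ 2 = 1 - t₁ := by exact_mod_cast t₁_sq
    have h4 : (t₂ : ℂ) ^ 2 = 1 - t₂ := by exact_mod_cast t₂_sq
    have e1 : ((u : ℂ) + v * t₁ + I) * ((x + y * t₁) * (3 + t₂) / 5) +
        (u + v * t₂ + I) * ((x + y * t₂) * (3 + t₁) / 5) =
        (x - y) * (u + 1 * I) + (2 * y - x) * (v + 0 * I) := by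
      have h5 : (t₂ : ℂ) = -1 - t₁ := by linear_combination h1
      rw [h5]
      linear_combination ((-2 * u * y - 2 * v * x + 7 * v * y - 2 * I * y) / 5) * h3
    rw [e1]
    ring
  · congr 1
    apply prod_ext
    · simp [sigma₁_vartheta]; ring
    · simp [sigma₂_vartheta]; ring

end GoldenHilbert
end

noncomputable section

namespace GoldenHilbert

open Complex TorusFourier Filter
open UpperHalfPlane hiding I
open scoped Real Topology

variable {w : ℕ} {f : ℍ × ℍ → ℂ}

lemma periodicOnTube_twist (hf : PeriodicOnTube (cover f)) (m n : ℤ) :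
    PeriodicOnTube (twist f m n) :=
  (periodicOnTube_ef m n).mul hf

lemma coeffAt_eq (hf : PeriodicOnTube (cover f)) (m n : ℤ) {α β : ℝ} (hQ : PosCone α β) :
    coeffAt f m n = torusMean (atHeight (twist f m n) α β) :=
  ((periodicOnTube_twist hf m n).torusMean_eq hQ).symm

lemma IsSymmetricHilbertModularForm.twist_conj (hf : IsSymmetricHilbertModularForm w f)
    (m n : ℤ) (a b : ℂ) : twist f m (-m - n) a b = twist f m n (a - b) (-b) := by
  have h : -((m : ℂ) * a + ((-m - n : ℤ) : ℂ) * b) = -(m * (a - b) + n * -b) := by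
    push_cast; ring
  rw [twist, twist, hf.cover_conj, h]

lemma IsHilbertModularForm.twist_theta (hf : IsHilbertModularForm w f) (m n : ℤ) {a b : ℂ}
    (hQ : PosCone a.im b.im) :
    (-1) ^ w * twist f (m - n) (2 * n - m) a b = twist f m n (a - b) (2 * b - a) := by
  have h : -(((m - n : ℤ) : ℂ) * a + ((2 * n - m : ℤ) : ℂ) * b) =
      -(m * (a - b) + n * (2 * b - a)) := by
    push_cast; ring
  rw [twist, twist, hf.cover_theta hQ, h, mul_left_comm]

lemma IsSymmetricHilbertModularForm.coeffAt_conj (hf : IsSymmetricHilbertModularForm w f)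
    (m n : ℤ) : coeffAt f m (-m - n) = coeffAt f m n := by
  have hP := periodicOnTube_twist hf.periodicOnTube m n
  have hQ := posCone_one_zero one_pos
  have h1 : atHeight (twist f m (-m - n)) 1 0 =
      fun x y => atHeight (twist f m n) 1 0 (x - y) (-y) := by
    ext x y
    rw [atHeight, hf.twist_conj, atHeight]
    apply congrArg₂
    · push_cast; ring
    · push_cast; ring
  have hcont := hP.continuous hQ
  have hleft := hP.atHeight_left hQ
  have hright := hP.atHeight_right hQ
  rw [coeffAt, coeffAt, h1]
  generalize atHeight (twist f m n) 1 0 = G at *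
  have hc : Continuous (Function.uncurry fun x y => G x (-y)) :=
    hcont.comp (by fun_prop : Continuous fun p : ℝ × ℝ => (p.1, -p.2))
  exact (torusMean_shear_left (F := fun x y => G x (-y)) hc fun x y => hleft x (-y)).trans
    (torusMean_neg_right hright)

lemma IsHilbertModularForm.coeffAt_theta (hf : IsHilbertModularForm w f) (m n : ℤ) :
    coeffAt f (m - n) (2 * n - m) = (-1) ^ w * coeffAt f m n := by
  have hP := periodicOnTube_twist hf.periodicOnTube m n
  have hQ := posCone_one_zero one_pos
  have hQ' : PosCone 1 (-1) := by simpa using posCone_theta hQ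
  have h1 : (fun x y => (-1) ^ w * atHeight (twist f (m - n) (2 * n - m)) 1 0 x y) =
      fun x y => atHeight (twist f m n) 1 (-1) (x - y) (y - (x - y)) := by
    ext x y
    rw [atHeight, hf.twist_theta m n (by simpa using hQ), atHeight]
    apply congrArg₂
    · push_cast; ring
    · push_cast; ring
  have hcont := hP.continuous hQ'
  have hleft := hP.atHeight_left hQ'
  have hright := hP.atHeight_right hQ'
  have h3 : (-1 : ℂ) ^ w * coeffAt f (m - n) (2 * n - m) = coeffAt f m n := by
    rw [coeffAt, ← torusMean_const_mul, h1, coeffAt_eq hf.periodicOnTube m n hQ']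
    generalize atHeight (twist f m n) 1 (-1) = G at *
    have hc : Continuous (Function.uncurry fun x y => G x (y - x)) :=
      hcont.comp (by fun_prop : Continuous fun p : ℝ × ℝ => (p.1, p.2 - p.1))
    have hper : ∀ x y : ℝ, G (x + 1) (y - (x + 1)) = G x (y - x) := fun x y => by
      rw [hleft, ← hright x (y - (x + 1))]
      congr 1; ring
    exact (torusMean_shear_left (F := fun x y => G x (y - x)) hc hper).trans
      (torusMean_shear_right hright)
  rw [← h3, ← mul_assoc, ← pow_add, Even.neg_one_pow ⟨w, rfl⟩, one_mul]

lemma twist_atHeight (m n : ℤ) (α β x y : ℝ) :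
    atHeight (twist f m n) α β x y =
      ef (-((α * m + β * n : ℝ) * I)) * (ef (-(m * x + n * y)) * atHeight (cover f) α β x y) := by
  simp only [atHeight, twist]
  rw [← mul_assoc, ← ef_add]
  congr 2
  push_cast
  ring

lemma norm_ef_ofReal_mul_I (c : ℝ) : ‖ef (c * I)‖ = Real.exp (-(2 * π * c)) := by
  rw [norm_ef]; simp

lemma norm_ef_neg_ofReal_mul_I (c : ℝ) : ‖ef (-(c * I))‖ = Real.exp (2 * π * c) := by
  rw [norm_ef]; simp

lemma exists_norm_coeffAt_le (hf : PeriodicOnTube (cover f)) {α β : ℝ} (hQ : PosCone α β) :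
    ∃ C : ℝ, 0 ≤ C ∧ ∀ m n : ℤ, ‖coeffAt f m n‖ ≤ C * Real.exp (2 * π * (α * m + β * n)) := by
  obtain ⟨C, hC⟩ := ((isCompact_Icc (a := (0 : ℝ)) (b := 1)).prod
    (isCompact_Icc (a := (0 : ℝ)) (b := 1))).exists_bound_of_continuousOn
    (hf.continuous hQ).continuousOn
  have hC' : ∀ x ∈ Set.Icc (0 : ℝ) 1, ∀ y ∈ Set.Icc (0 : ℝ) 1,
      ‖atHeight (cover f) α β x y‖ ≤ C := fun x hx y hy => hC (x, y) ⟨hx, hy⟩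
  refine ⟨C, (norm_nonneg _).trans (hC' 0 (by simp) 0 (by simp)), fun m n => ?_⟩
  rw [coeffAt_eq hf m n hQ]
  refine norm_torusMean_le fun x hx y hy => ?_
  rw [twist_atHeight, norm_mul, norm_mul, norm_ef_neg_ofReal_mul_I, norm_ef]
  have h0 : (-((m : ℂ) * x + n * y)).im = 0 := by simp
  rw [h0]
  simp only [mul_zero, neg_zero, Real.exp_zero, one_mul]
  rw [mul_comm]
  exact mul_le_mul_of_nonneg_right (hC' x hx y hy) (Real.exp_pos _).le

lemma t₁_sub_t₂_pos : 0 < t₁ - t₂ := by linarith [t₁_bounds.1, t₂_eq]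

lemma IsHilbertModularForm.norm_coeffAt_iterate (hf : IsHilbertModularForm w f) (k : ℕ) (m n : ℤ) :
    ∃ m' n' : ℤ, ‖coeffAt f m' n'‖ = ‖coeffAt f m n‖ ∧
      t₁ * m' - n' = (t₂ ^ 2) ^ k * (t₁ * m - n) ∧ n' - t₂ * m' = (t₁ ^ 2) ^ k * (n - t₂ * m) := by
  induction k with
  | zero => exact ⟨m, n, rfl, by simp, by simp⟩
  | succ k ih =>
    obtain ⟨m', n', h1, h2, h3⟩ := ih
    refine ⟨m' - n', 2 * n' - m', ?_, ?_, ?_⟩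
    · rw [hf.coeffAt_theta, norm_mul, h1]; simp
    · rw [pow_succ, mul_right_comm, ← h2, t₂_sq]
      push_cast
      linear_combination (m' : ℝ) * t₁_mul_t₂ - n' * t₁_add_t₂
    · rw [pow_succ, mul_right_comm, ← h3, t₁_sq]
      push_cast
      linear_combination (-m' : ℝ) * t₁_mul_t₂ + n' * t₁_add_t₂

/-- The Koecher principle, first half. -/
lemma IsHilbertModularForm.le_of_coeffAt_ne_zero (hf : IsHilbertModularForm w f) {m n : ℤ}
    (h : coeffAt f m n ≠ 0) : (n : ℝ) ≤ t₁ * m := by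
  by_contra hneg
  obtain ⟨C, hC0, hC⟩ := exists_norm_coeffAt_le hf.periodicOnTube (posCone_one_zero one_pos)
  have hd := t₁_sub_t₂_pos
  have hbound : ∀ k : ℕ, ‖coeffAt f m n‖ ≤ C * Real.exp (2 * π *
      (((t₂ ^ 2) ^ k * (t₁ * m - n) + (t₁ ^ 2) ^ k * (n - t₂ * m)) / (t₁ - t₂))) := fun k => by
    obtain ⟨m', n', h1, h2, h3⟩ := hf.norm_coeffAt_iterate k m n
    rw [← h1, ← h2, ← h3]
    refine (hC m' n').trans_eq ?_
    congr 3
    field_simp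
    ring
  have ht1 : Tendsto (fun k : ℕ => (t₁ ^ 2) ^ k * (n - t₂ * m)) atTop (𝓝 (0 * (n - t₂ * m))) := by
    refine Tendsto.mul_const _ (tendsto_pow_atTop_nhds_zero_of_lt_one (by positivity) ?_)
    rw [t₁_sq]; linarith [t₁_bounds.1]
  have ht2 : Tendsto (fun k : ℕ => (t₂ ^ 2) ^ k * (t₁ * m - n)) atTop atBot := by
    refine Tendsto.atTop_mul_const_of_neg (by linarith) (tendsto_pow_atTop_atTop_of_one_lt ?_)
    rw [t₂_sq]; linarith [t₁_bounds.1, t₂_eq]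
  have ht3 : Tendsto (fun k : ℕ => 2 * π *
      (((t₂ ^ 2) ^ k * (t₁ * m - n) + (t₁ ^ 2) ^ k * (n - t₂ * m)) / (t₁ - t₂))) atTop atBot :=
    ((ht2.atBot_add ht1).atBot_div_const hd).const_mul_atBot (by positivity)
  have ht4 := (Real.tendsto_exp_atBot.comp ht3).const_mul C
  rw [mul_zero] at ht4
  have := ge_of_tendsto' ht4 hbound
  exact h (norm_le_zero_iff.1 this)

/-- The Koecher principle. -/
lemma IsSymmetricHilbertModularForm.koecher (hf : IsSymmetricHilbertModularForm w f) {m n : ℤ}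
    (h : coeffAt f m n ≠ 0) : t₂ * m ≤ n ∧ (n : ℝ) ≤ t₁ * m := by
  refine ⟨?_, hf.le_of_coeffAt_ne_zero h⟩
  rw [← hf.coeffAt_conj] at h
  have := hf.le_of_coeffAt_ne_zero h
  push_cast at this
  rw [t₂_eq]
  linarith

lemma nonneg_of_cone {m n : ℤ} (h : t₂ * m ≤ n ∧ (n : ℝ) ≤ t₁ * m) {α β : ℝ}
    (h1 : 0 ≤ α + β * t₁) (h2 : 0 ≤ α + β * t₂) : 0 ≤ α * m + β * n := by
  have h3 : (t₁ - t₂) * (α * m + β * n) =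
      (α + β * t₂) * (t₁ * m - n) + (α + β * t₁) * (n - t₂ * m) := by ring
  refine nonneg_of_mul_nonneg_right ?_ t₁_sub_t₂_pos
  rw [h3]
  exact add_nonneg (mul_nonneg h2 (by linarith [h.2])) (mul_nonneg h1 (by linarith [h.1]))

lemma abs_add_abs_le_of_cone {m n : ℤ} (h : t₂ * m ≤ n ∧ (n : ℝ) ≤ t₁ * m) :
    0 ≤ m ∧ |(m : ℝ)| + |(n : ℝ)| ≤ 3 * m := by
  have h0 : (0 : ℝ) ≤ m := by
    have := nonneg_of_cone h (α := 1) (β := 0) (by simp) (by simp)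
    simpa using this
  refine ⟨by exact_mod_cast h0, ?_⟩
  rw [abs_of_nonneg h0]
  have : |(n : ℝ)| ≤ 2 * m := by
    rw [abs_le]
    constructor <;> nlinarith [t₁_bounds.1, t₁_bounds.2, t₂_eq, h.1, h.2]
  linarith

lemma summable_exp_neg_abs {c : ℝ} (hc : 0 < c) : Summable fun n : ℤ => Real.exp (-(c * |(n : ℝ)|)) := by
  have h : Summable fun n : ℕ => Real.exp (-(c * |(n : ℝ)|)) := by
    have := Real.summable_exp_nat_mul_iff.2 (neg_neg_of_pos hc)
    refine this.congr fun n => ?_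
    rw [Nat.abs_cast]; ring_nf
  exact Summable.of_nat_of_neg (by simpa using h) (by simpa using h)

/-- Absolute convergence of the Fourier expansion. -/
lemma IsSymmetricHilbertModularForm.summable_norm (hf : IsSymmetricHilbertModularForm w f) {δ : ℝ}
    (hδ : 0 < δ) : Summable fun p : ℤ × ℤ => ‖coeffAt f p.1 p.2‖ * Real.exp (-(2 * π * (δ * p.1))) := by
  obtain ⟨C, hC0, hC⟩ := exists_norm_coeffAt_le hf.periodicOnTube (posCone_one_zero (half_pos hδ))
  set c := π * δ / 3 with hc
  have hc0 : 0 < c := by positivity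
  have hs := summable_exp_neg_abs hc0
  have hs2 := (hs.mul_of_nonneg hs (fun _ => (Real.exp_pos _).le) fun _ => (Real.exp_pos _).le).mul_left C
  refine Summable.of_nonneg_of_le (fun p => by positivity) (fun p => ?_) hs2
  by_cases h0 : coeffAt f p.1 p.2 = 0
  · rw [h0, norm_zero, zero_mul]
    positivity
  have hk := (abs_add_abs_le_of_cone (hf.koecher h0)).2
  calc _ ≤ (C * Real.exp (2 * π * (δ / 2 * p.1 + 0 * p.2))) * Real.exp (-(2 * π * (δ * p.1))) :=
        mul_le_mul_of_nonneg_right (hC _ _) (Real.exp_pos _).le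
    _ = C * Real.exp (-(π * δ * p.1)) := by
        rw [mul_assoc, ← Real.exp_add]; congr 2; ring
    _ ≤ C * (Real.exp (-(c * |(p.1 : ℝ)|)) * Real.exp (-(c * |(p.2 : ℝ)|))) := by
        refine mul_le_mul_of_nonneg_left ?_ hC0
        rw [← Real.exp_add, Real.exp_le_exp, hc]
        have : 0 < π * δ := by positivity
        nlinarith

/-- The norm of a term of the Fourier expansion. -/
lemma IsSymmetricHilbertModularForm.norm_term_le (hf : IsSymmetricHilbertModularForm w f)
    (m n : ℤ) {α β δ : ℝ} (h1 : δ ≤ α + β * t₁) (h2 : δ ≤ α + β * t₂) :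
    ‖coeffAt f m n‖ * Real.exp (-(2 * π * (α * m + β * n))) ≤
      ‖coeffAt f m n‖ * Real.exp (-(2 * π * (δ * m))) := by
  by_cases h0 : coeffAt f m n = 0
  · simp [h0]
  refine mul_le_mul_of_nonneg_left ?_ (norm_nonneg _)
  rw [Real.exp_le_exp]
  have := nonneg_of_cone (hf.koecher h0) (α := α - δ) (β := β) (by linarith) (by linarith)
  have := mul_nonneg Real.two_pi_pos.le this
  linarith

/-- The Fourier expansion. -/
theorem IsSymmetricHilbertModularForm.hasSum_cover (hf : IsSymmetricHilbertModularForm w f)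
    {a b : ℂ} (hQ : PosCone a.im b.im) :
    HasSum (fun p : ℤ × ℤ => coeffAt f p.1 p.2 * ef (p.1 * a + p.2 * b)) (cover f a b) := by
  set α := a.im with hα
  set β := b.im with hβ
  set F := atHeight (cover f) α β with hF
  have hP := hf.periodicOnTube
  have hcoef : ∀ m n : ℤ, torusMean (fun x y : ℝ => ef (-(m * x + n * y)) * F x y) =
      coeffAt f m n * ef ((α * m + β * n : ℝ) * I) := fun m n => by
    have h1 : atHeight (twist f m n) α β = fun x y : ℝ =>
        ef (-((α * m + β * n : ℝ) * I)) * (ef (-(m * x + n * y)) * F x y) := by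
      ext x y; rw [twist_atHeight]
    rw [coeffAt_eq hP m n hQ, h1, torusMean_const_mul, mul_right_comm, ← ef_add, neg_add_cancel,
      ef_zero, one_mul]
  have hsum : Summable fun p : ℤ × ℤ => torusMean fun x y : ℝ => ef (-(p.1 * x + p.2 * y)) * F x y := by
    obtain ⟨δ, hδ, hδ1, hδ2⟩ : ∃ δ : ℝ, 0 < δ ∧ δ ≤ α + β * t₁ ∧ δ ≤ α + β * t₂ :=
      ⟨min _ _, lt_min hQ.1 hQ.2, min_le_left _ _, min_le_right _ _⟩
    refine Summable.of_norm_bounded (hf.summable_norm hδ) fun p => ?_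
    rw [hcoef, norm_mul, norm_ef_ofReal_mul_I]
    exact hf.norm_term_le p.1 p.2 hδ1 hδ2
  have h := hasSum_fourier (hP.continuous hQ) (hP.atHeight_left hQ) (hP.atHeight_right hQ) hsum
    a.re b.re
  have hval : atHeight (cover f) α β a.re b.re = cover f a b := by
    rw [atHeight, hα, hβ, Complex.re_add_im, Complex.re_add_im]
  rw [hval] at h
  refine h.congr_fun fun p => ?_
  rw [← hF, hcoef, mul_assoc, ← ef_add]
  congr 2
  conv_lhs => rw [← Complex.re_add_im a, ← Complex.re_add_im b]
  push_cast
  ring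

end GoldenHilbert
end

noncomputable section

namespace GoldenHilbert

open Complex TorusFourier ModularForm ModularFormClass MatrixGroups
open UpperHalfPlane hiding I
open scoped Real Topology PowerSeries

variable {w : ℕ} {f : ℍ × ℍ → ℂ}

/-- The restriction of `f` to the diagonal. -/
def diag (f : ℍ × ℍ → ℂ) (τ : ℍ) : ℂ := f (τ, τ)

/-- The `q`-expansion of the restriction to the diagonal. -/
def diagSeries (f : ℍ × ℍ → ℂ) : ℂ⟦X⟧ := .mk fun m => ∑' n : ℤ, coeffAt f m n

lemma act_map_intCast (γ : SL(2, ℤ)) (τ : ℍ) :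
    act (Matrix.SpecialLinearGroup.map (Int.castRingHom R) γ) (τ, τ) = (γ • τ, γ • τ) := by
  apply prod_ext
  · rw [coe_act_fst, coe_specialLinearGroup_apply]
    simp
  · rw [coe_act_snd, coe_specialLinearGroup_apply]
    simp

lemma IsHilbertModularForm.diag_slash (hf : IsHilbertModularForm w f) (γ : SL(2, ℤ)) :
    diag f ∣[((2 * w : ℕ) : ℤ)] γ = diag f := by
  ext τ
  have h := hf.transform (Matrix.SpecialLinearGroup.map (Int.castRingHom R) γ) (τ, τ)
  rw [act_map_intCast] at h
  have hd : denom γ τ ≠ 0 := denom_ne_zero _ _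
  rw [ModularForm.SL_slash_apply, diag, h, zpow_neg, zpow_natCast, pow_mul, diag]
  have h2 : ((sigma₁ (Matrix.SpecialLinearGroup.map (Int.castRingHom R) γ 1 0) : ℂ) * τ +
      sigma₁ (Matrix.SpecialLinearGroup.map (Int.castRingHom R) γ 1 1)) *
        ((sigma₂ (Matrix.SpecialLinearGroup.map (Int.castRingHom R) γ 1 0) : ℂ) * τ +
          sigma₂ (Matrix.SpecialLinearGroup.map (Int.castRingHom R) γ 1 1)) = denom γ τ ^ 2 := by
    rw [denom]
    simp [sq]
  rw [h2]
  field_simp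

lemma IsSymmetricHilbertModularForm.hasQSeries_diag (hf : IsSymmetricHilbertModularForm w f) :
    LevelOne.HasQSeries (diag f) (diagSeries f) := by
  intro τ
  have h := hf.hasSum_cover (a := τ) (b := 0) (posCone_one_zero τ.im_pos)
  have hv : cover f τ 0 = diag f τ := by
    rw [cover, diag]; simp
  rw [hv] at h
  have h1 := h.prod_fiberwise fun n => (h.summable.prod_factor n).hasSum
  have hinj : Function.Injective (Nat.cast : ℕ → ℤ) := Nat.cast_injective
  rw [← hinj.hasSum_iff] at h1
  · refine h1.congr_fun fun n => ?_
    rw [diagSeries, PowerSeries.coeff_mk, Function.comp_apply, smul_eq_mul, ← tsum_mul_right]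
    refine tsum_congr fun m => ?_
    congr 1
    rw [ef, Function.Periodic.qParam, ← exp_nat_mul]
    congr 1
    push_cast
    ring
  · intro n hn
    have h0 : ∀ m, coeffAt f n m = 0 := fun m => by
      by_contra hne
      have := (abs_add_abs_le_of_cone (hf.koecher hne)).1
      exact hn ⟨n.toNat, Int.toNat_of_nonneg this⟩
    simp [h0]

/-- The restriction to the diagonal, as a modular form of level one. -/
def IsSymmetricHilbertModularForm.diagForm (hf : IsSymmetricHilbertModularForm w f) :
    ModularForm 𝒮ℒ ((2 * w : ℕ) : ℤ) where
  toFun := diag f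
  slash_action_eq' := by
    rintro _ ⟨γ, rfl⟩
    exact hf.diag_slash γ
  holo' := by
    rw [mdifferentiable_iff]
    have h : DifferentiableOn ℂ ((fun p : ℂ × ℂ => f (ofComplex p.1, ofComplex p.2)) ∘
        fun z : ℂ => (z, z)) {z | 0 < z.im} :=
      hf.holomorphic.comp (by fun_prop) fun z hz => ⟨hz, hz⟩
    exact h
  bdd_at_cusps' {c} hc := by
    rw [Subgroup.IsArithmetic.isCusp_iff_isCusp_SL2Z] at hc
    rw [OnePoint.isBoundedAt_iff_forall_SL2Z hc]
    intro γ _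
    rw [hf.diag_slash γ]
    exact isBoundedAtImInfty_of_hasSum_qExpansion one_pos hf.hasQSeries_diag

theorem IsSymmetricHilbertModularForm.exists_coeffAt_ne_zero
    (hf : IsSymmetricHilbertModularForm w f) (hw : w ≠ 0) (h0 : coeffAt f 0 0 = 1) :
    ∃ m n : ℤ, m ≠ 0 ∧ m ≤ w / 6 + 1 ∧ coeffAt f m n ≠ 0 := by
  have hq : qExpansion 1 hf.diagForm = diagSeries f :=
    (LevelOne.hasQSeries_qExpansion hf.diagForm).unique hf.hasQSeries_diag
  have h1 : PowerSeries.coeff 0 (qExpansion 1 hf.diagForm) = 1 := by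
    rw [hq, diagSeries, PowerSeries.coeff_mk, tsum_eq_single 0, ← h0]
    · rfl
    · intro n hn
      by_contra hne
      have := (abs_add_abs_le_of_cone (hf.koecher hne)).2
      have h2 : |(n : ℝ)| ≤ 0 := by simpa using this
      exact hn (by exact_mod_cast abs_nonpos_iff.1 h2)
  obtain ⟨m, hm0, hm, hm1⟩ := LevelOne.exists_coeff_ne_zero (by omega : 2 * w ≠ 0) ⟨w, by ring⟩ _ h1
  rw [hq, diagSeries, PowerSeries.coeff_mk] at hm1
  obtain ⟨n, hn⟩ : ∃ n : ℤ, coeffAt f m n ≠ 0 := by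
    by_contra! h
    exact hm1 (by simp [h])
  exact ⟨m, n, by exact_mod_cast hm0, by omega, hn⟩

end GoldenHilbert
end

noncomputable section

namespace GoldenHilbert

open Complex TorusFourier Filter
open UpperHalfPlane hiding I
open scoped Real Topology

variable {w : ℕ} {f : ℍ × ℍ → ℂ}

lemma sigma₁_thetaUnit_zpow (k : ℤ) : sigma₁ ((thetaUnit ^ k : Rˣ) : R) = t₁ ^ k := by
  have h := map_zpow (Units.map (sigma₁ : R →* ℝ)) thetaUnit k
  have h2 := congrArg (Units.val) h
  rw [Units.val_zpow_eq_zpow_val] at h2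
  have h3 : ((Units.map (sigma₁ : R →* ℝ) thetaUnit : ℝˣ) : ℝ) = t₁ := sigma₁_vartheta
  rw [h3] at h2
  exact h2

lemma sigma₂_thetaUnit_zpow (k : ℤ) : sigma₂ ((thetaUnit ^ k : Rˣ) : R) = t₂ ^ k := by
  have h := map_zpow (Units.map (sigma₂ : R →* ℝ)) thetaUnit k
  have h2 := congrArg (Units.val) h
  rw [Units.val_zpow_eq_zpow_val] at h2
  have h3 : ((Units.map (sigma₂ : R →* ℝ) thetaUnit : ℝˣ) : ℝ) = t₂ := sigma₂_vartheta
  rw [h3] at h2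
  exact h2

/-- Points reduced with respect to the stabilizer of the cusp. -/
structure CuspReduced (z : ℍ × ℍ) : Prop where
  re_mem : ∃ u v : ℝ, |u| ≤ 1 / 2 ∧ |v| ≤ 1 / 2 ∧ z.1.re = u + v * t₁ ∧ z.2.re = u + v * t₂
  le_im : z.2.im ≤ z.1.im
  im_le : z.1.im ≤ 7 * z.2.im

lemma exists_scale (y₁ y₂ : ℝ) (h₁ : 0 < y₁) (h₂ : 0 < y₂) : ∃ k : ℤ,
    (t₂ ^ k) ^ 2 * y₂ ≤ (t₁ ^ k) ^ 2 * y₁ ∧ (t₁ ^ k) ^ 2 * y₁ ≤ 7 * ((t₂ ^ k) ^ 2 * y₂) := by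
  have ht1 : t₁ ≠ 0 := by linarith [t₁_bounds.1]
  have ht1' : 0 < t₁ ^ 2 := by positivity
  set ρ := (t₂ / t₁) ^ 2 with hρ
  have hρ' : ρ = (1 - t₂) / (1 - t₁) := by rw [hρ, div_pow, t₁_sq, t₂_sq]
  have hd : 0 < 1 - t₁ := by linarith [t₁_bounds.2]
  have hρ1 : 1 < ρ := by
    rw [hρ', lt_div_iff₀ hd]; linarith [t₁_bounds.1, t₂_eq]
  have hρ7 : ρ ≤ 7 := by
    rw [hρ', div_le_iff₀ hd]; linarith [t₁_bounds.2, t₂_eq]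
  obtain ⟨k, hk1, hk2⟩ := exists_mem_Ico_zpow (div_pos h₁ h₂) hρ1
  rw [le_div_iff₀ h₂] at hk1
  rw [div_lt_iff₀ h₂, zpow_add_one₀ (by linarith)] at hk2
  have hA : (t₁ ^ k) ^ 2 * ρ ^ k = (t₂ ^ k) ^ 2 := by
    rw [hρ, ← zpow_natCast (t₂ / t₁), zpow_comm, zpow_natCast, div_zpow, div_pow,
      mul_div_cancel₀ _ (pow_ne_zero _ (zpow_ne_zero _ ht1))]
  have hA0 : 0 < (t₁ ^ k) ^ 2 := pow_pos (zpow_pos (by linarith [t₁_bounds.1]) _) _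
  have hB : 0 < ρ ^ k * y₂ := mul_pos (zpow_pos (by linarith) _) h₂
  refine ⟨k, ?_, ?_⟩
  · rw [← hA, mul_assoc]
    exact mul_le_mul_of_nonneg_left hk1 hA0.le
  · rw [← hA]
    have : y₁ ≤ 7 * (ρ ^ k * y₂) := by nlinarith
    nlinarith

lemma exists_cuspReduced (z : ℍ × ℍ) : ∃ M, CuspReduced (act M z) ∧
    (act M z).1.im * (act M z).2.im = z.1.im * z.2.im := by
  obtain ⟨k, hk1, hk2⟩ := exists_scale z.1.im z.2.im z.1.im_pos z.2.im_pos
  set z' := act (diagonal (thetaUnit ^ k)) z with hz'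
  obtain ⟨e1, e2⟩ := coe_act_diagonal (thetaUnit ^ k) z
  rw [← hz', sigma₁_thetaUnit_zpow] at e1
  rw [← hz', sigma₂_thetaUnit_zpow] at e2
  have i1 : z'.1.im = (t₁ ^ k) ^ 2 * z.1.im := by
    have := congrArg Complex.im e1
    rw [← ofReal_pow, im_ofReal_mul] at this
    exact this
  have i2 : z'.2.im = (t₂ ^ k) ^ 2 * z.2.im := by
    have := congrArg Complex.im e2
    rw [← ofReal_pow, im_ofReal_mul] at this
    exact this
  set v := (z'.1.re - z'.2.re) / (t₁ - t₂) with hv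
  set u := z'.1.re - v * t₁ with hu
  have hne : t₁ - t₂ ≠ 0 := t₁_sub_t₂_pos.ne'
  have hv' : v * (t₁ - t₂) = z'.1.re - z'.2.re := by rw [hv, div_mul_cancel₀ _ hne]
  obtain ⟨g1, g2⟩ := coe_act_translation ⟨-round u, -round v⟩ z'
  rw [sigma₁_mk] at g1
  rw [sigma₂_mk] at g2
  set z'' := act (translation ⟨-round u, -round v⟩) z' with hz''
  have j1 : z''.1.im = z'.1.im := by
    have := congrArg Complex.im g1
    simp only [add_im, ofReal_im, add_zero] at this
    exact this
  have j2 : z''.2.im = z'.2.im := by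
    have := congrArg Complex.im g2
    simp only [add_im, ofReal_im, add_zero] at this
    exact this
  have r1 : z''.1.re = (u - round u) + (v - round v) * t₁ := by
    have := congrArg Complex.re g1
    simp only [add_re, ofReal_re] at this
    have h3 : z''.1.re = z'.1.re + (((-round u : ℤ) : ℝ) + ((-round v : ℤ) : ℝ) * t₁) := this
    rw [h3, hu]; push_cast; ring
  have r2 : z''.2.re = (u - round u) + (v - round v) * t₂ := by
    have := congrArg Complex.re g2
    simp only [add_re, ofReal_re] at this
    have h3 : z''.2.re = z'.2.re + (((-round u : ℤ) : ℝ) + ((-round v : ℤ) : ℝ) * t₂) := this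
    rw [h3]; push_cast
    linear_combination -hu + hv'
  refine ⟨translation ⟨-round u, -round v⟩ * diagonal (thetaUnit ^ k), ?_, ?_⟩
  · rw [act_mul, ← hz', ← hz'']
    refine ⟨⟨_, _, abs_sub_round u, abs_sub_round v, r1, r2⟩, ?_, ?_⟩
    · rw [j1, j2, i1, i2]; exact hk1
    · rw [j1, j2, i1, i2]; exact hk2
  · rw [act_mul, ← hz', ← hz'', j1, j2, i1, i2]
    have : (t₁ ^ k) ^ 2 * (t₂ ^ k) ^ 2 = 1 := by
      rw [← mul_pow, ← mul_zpow, t₁_mul_t₂]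
      rcases Int.even_or_odd k with h | h
      · rw [h.neg_one_zpow]; norm_num
      · rw [h.neg_one_zpow]; norm_num
    linear_combination (z.1.im * z.2.im) * this

lemma im_act_inversion (z : ℍ × ℍ) :
    (act inversion z).1.im = z.1.im / (z.1.re ^ 2 + z.1.im ^ 2) ∧
      (act inversion z).2.im = z.2.im / (z.2.re ^ 2 + z.2.im ^ 2) := by
  have key : ∀ τ τ' : ℍ, (τ' : ℂ) = -1 / τ → τ'.im = τ.im / (τ.re ^ 2 + τ.im ^ 2) := by
    intro τ τ' h
    have := congrArg Complex.im h
    rw [neg_div, neg_im, one_div, Complex.inv_im, normSq_apply] at this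
    change τ'.im = -(-τ.im / (τ.re * τ.re + τ.im * τ.im)) at this
    rw [this, neg_div, neg_neg, sq, sq]
  exact ⟨key _ _ (coe_act_inversion z).1, key _ _ (coe_act_inversion z).2⟩

lemma CuspReduced.two_mul_le {z : ℍ × ℍ} (h : CuspReduced z) (hN : z.1.im * z.2.im ≤ 1 / 40) :
    2 * (z.1.im * z.2.im) ≤ (act inversion z).1.im * (act inversion z).2.im := by
  obtain ⟨u, v, hu, hv, h1, h2⟩ := h.re_mem
  have h3 := h.le_im
  have h4 := h.im_le
  rw [(im_act_inversion z).1, (im_act_inversion z).2, div_mul_div_comm]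
  have p1 := z.1.im_pos
  have p2 := z.2.im_pos
  generalize z.1.im = y₁ at *
  generalize z.2.im = y₂ at *
  generalize z.1.re = x₁ at *
  generalize z.2.re = x₂ at *
  rw [le_div_iff₀ (by positivity)]
  rw [abs_le] at hu hv
  have hx : x₁ * x₂ = u ^ 2 - u * v - v ^ 2 := by
    rw [h1, h2]; linear_combination u * v * t₁_add_t₂ + v ^ 2 * t₁_mul_t₂
  have hx1 : |x₁ * x₂| ≤ 5 / 16 := by
    rw [hx, abs_le]
    constructor
    · nlinarith [sq_nonneg (u - v / 2), sq_nonneg (u + v / 2), mul_nonneg (sub_nonneg.2 hv.1) (sub_nonneg.2 hv.2)]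
    · nlinarith [sq_nonneg (v - u / 2), sq_nonneg (v + u / 2), mul_nonneg (sub_nonneg.2 hu.1) (sub_nonneg.2 hu.2)]
  have hx2 : |x₁| ≤ 1 := by
    rw [h1, abs_le]
    constructor <;> nlinarith [t₁_bounds.1, t₁_bounds.2]
  have hx3 : |x₂| ≤ 1.31 := by
    rw [h2, abs_le, t₂_eq]
    constructor <;> nlinarith [t₁_bounds.1, t₁_bounds.2]
  have s1 : (x₁ * x₂) ^ 2 ≤ (5 / 16) ^ 2 := sq_le_sq' (abs_le.1 hx1).1 (abs_le.1 hx1).2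
  have s2 : x₁ ^ 2 ≤ 1 ^ 2 := sq_le_sq' (abs_le.1 hx2).1 (abs_le.1 hx2).2
  have s3 : x₂ ^ 2 ≤ 1.31 ^ 2 := sq_le_sq' (abs_le.1 hx3).1 (abs_le.1 hx3).2
  have k1 : y₁ ^ 2 ≤ 7 / 40 := by nlinarith
  have k2 : y₂ ^ 2 ≤ 1 / 40 := by nlinarith
  have hfin : (x₁ ^ 2 + y₁ ^ 2) * (x₂ ^ 2 + y₂ ^ 2) ≤ 1 / 2 := by
    have a1 : x₁ ^ 2 * y₂ ^ 2 ≤ 1 ^ 2 * (1 / 40) := by gcongr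
    have a2 : y₁ ^ 2 * x₂ ^ 2 ≤ (7 / 40) * 1.31 ^ 2 := by gcongr
    have a3 : y₁ ^ 2 * y₂ ^ 2 ≤ (7 / 40) * (1 / 40) := by gcongr
    nlinarith
  have hpos : 0 < y₁ * y₂ := mul_pos p1 p2
  nlinarith

/-- The reduction theory of `SL₂(R)`. -/
theorem exists_reduced (z : ℍ × ℍ) : ∃ M, CuspReduced (act M z) ∧ 1 / 20 ≤ (act M z).2.im := by
  have key : ∀ (n : ℕ) (z : ℍ × ℍ), 1 / 40 ≤ z.1.im * z.2.im * 2 ^ n →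
      ∃ M, CuspReduced (act M z) ∧ 1 / 40 ≤ (act M z).1.im * (act M z).2.im := by
    intro n
    induction n with
    | zero =>
      intro z hz
      obtain ⟨M, h1, h2⟩ := exists_cuspReduced z
      exact ⟨M, h1, by rw [h2]; simpa using hz⟩
    | succ n ih =>
      intro z hz
      obtain ⟨M, h1, h2⟩ := exists_cuspReduced z
      rcases le_total (1 / 40) ((act M z).1.im * (act M z).2.im) with h | h
      · exact ⟨M, h1, h⟩
      · obtain ⟨M', h3⟩ := ih (act inversion (act M z)) (by
          have h4 := h1.two_mul_le h
          rw [h2] at h4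
          have h5 := mul_le_mul_of_nonneg_right h4 (pow_nonneg zero_le_two n)
          rw [pow_succ] at hz
          linarith)
        exact ⟨M' * (inversion * M), by rwa [act_mul, act_mul]⟩
  have hN : 0 < z.1.im * z.2.im := mul_pos z.1.im_pos z.2.im_pos
  obtain ⟨n, hn⟩ := pow_unbounded_of_one_lt (1 / 40 / (z.1.im * z.2.im)) one_lt_two
  rw [div_lt_iff₀ hN] at hn
  obtain ⟨M, h1, h2⟩ := key n z (by linarith)
  refine ⟨M, h1, ?_⟩
  have h3 := h1.im_le
  have h4 := (act M z).2.im_pos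
  nlinarith

lemma exists_cover_eq (f : ℍ × ℍ → ℂ) (z : ℍ × ℍ) : ∃ a b : ℂ, a.im + b.im * t₁ = z.1.im ∧
    a.im + b.im * t₂ = z.2.im ∧ cover f a b = f z := by
  set b : ℂ := (z.1 - z.2) / ((t₁ - t₂ : ℝ) : ℂ) with hb
  have hne : ((t₁ - t₂ : ℝ) : ℂ) ≠ 0 := ofReal_ne_zero.2 t₁_sub_t₂_pos.ne'
  have hb' : b * ((t₁ - t₂ : ℝ) : ℂ) = z.1 - z.2 := div_mul_cancel₀ _ hne
  push_cast at hb'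
  have h1 : (z.1 - b * t₁) + b * t₁ = (z.1 : ℂ) := by ring
  have h2 : (z.1 - b * t₁) + b * t₂ = (z.2 : ℂ) := by linear_combination -hb'
  refine ⟨z.1 - b * t₁, b, ?_, ?_, ?_⟩
  · rw [← im_add_mul_ofReal, h1]; rfl
  · rw [← im_add_mul_ofReal, h2]; rfl
  · rw [cover, h1, h2, ofComplex_apply, ofComplex_apply]

lemma IsSymmetricHilbertModularForm.exists_norm_le (hf : IsSymmetricHilbertModularForm w f)
    (h0 : coeffAt f 0 0 = 0) {c : ℝ} (hc : 0 < c) : ∃ K : ℝ, ∀ (z : ℍ × ℍ) (Y : ℝ), c ≤ Y →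
      Y ≤ z.1.im → Y ≤ z.2.im → ‖f z‖ ≤ K * Real.exp (-(2 * π * (Y - c))) := by
  refine ⟨∑' p : ℤ × ℤ, ‖coeffAt f p.1 p.2‖ * Real.exp (-(2 * π * (c * p.1))),
    fun z Y hY h1 h2 => ?_⟩
  obtain ⟨a, b, e1, e2, e3⟩ := exists_cover_eq f z
  rw [← e3]
  have hQ : PosCone a.im b.im := ⟨by rw [e1]; exact z.1.im_pos, by rw [e2]; exact z.2.im_pos⟩
  have hs := (hf.summable_norm hc).hasSum.mul_right (Real.exp (-(2 * π * (Y - c))))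
  refine (hf.hasSum_cover hQ).norm_le_of_bounded hs fun p => ?_
  have h3 : (p.1 * a + p.2 * b : ℂ).im = a.im * p.1 + b.im * p.2 := by
    simp; ring
  rw [norm_mul, norm_ef, h3]
  refine (hf.norm_term_le p.1 p.2 (δ := Y) (by rwa [e1]) (by rwa [e2])).trans ?_
  rw [mul_assoc ‖coeffAt f p.1 p.2‖, ← Real.exp_add]
  by_cases hp : coeffAt f p.1 p.2 = 0
  · simp [hp]
  refine mul_le_mul_of_nonneg_left (Real.exp_le_exp.2 ?_) (norm_nonneg _)
  have hk := abs_add_abs_le_of_cone (hf.koecher hp)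
  have hm : (1 : ℝ) ≤ p.1 := by
    have : p.1 ≠ 0 := fun h => by
      have h5 := hk.2
      rw [h] at h5
      have h6 : p.2 = 0 := by simpa using h5
      rw [h, h6] at hp
      exact hp h0
    have h7 : 1 ≤ p.1 := by omega
    exact_mod_cast h7
  have h8 : 0 ≤ 2 * π * ((Y - c) * (p.1 - 1)) :=
    mul_nonneg Real.two_pi_pos.le (mul_nonneg (by linarith) (by linarith))
  linarith

lemma isPreconnected_upperHalfPlane_prod :
    IsPreconnected {p : ℂ × ℂ | 0 < p.1.im ∧ 0 < p.2.im} := by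
  have h : Convex ℝ {z : ℂ | 0 < z.im} := convex_halfSpace_im_gt 0
  exact (h.prod h).isPreconnected

/-- A form of weight 0 with vanishing constant term is zero. -/
theorem IsSymmetricHilbertModularForm.eq_zero_of_weight_zero
    (hf : IsSymmetricHilbertModularForm 0 f) (h0 : coeffAt f 0 0 = 0) : f = 0 := by
  by_contra hne
  obtain ⟨z₀, hz₀⟩ := Function.ne_iff.1 hne
  set ε := ‖f z₀‖ with hε
  have hε0 : 0 < ε := norm_pos_iff.2 hz₀
  obtain ⟨K, hK⟩ := hf.exists_norm_le h0 (c := 1 / 20) (by norm_num)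
  have hinv : ∀ M z, f (act M z) = f z := fun M z => by rw [hf.transform]; simp
  obtain ⟨T, hT1, hT2⟩ : ∃ T : ℝ, 1 / 20 ≤ T ∧ ∀ z : ℍ × ℍ, T ≤ z.1.im → T ≤ z.2.im → ‖f z‖ < ε := by
    have hlim : Tendsto (fun Y : ℝ => K * Real.exp (-(2 * π * (Y - 1 / 20)))) atTop (𝓝 (K * 0)) := by
      refine (Real.tendsto_exp_atBot.comp ?_).const_mul K
      exact tendsto_neg_atTop_atBot.comp
        ((tendsto_atTop_add_const_right _ _ tendsto_id).const_mul_atTop Real.two_pi_pos)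
    rw [mul_zero] at hlim
    obtain ⟨T, hT, hT'⟩ := ((hlim.eventually_lt_const hε0).and (eventually_ge_atTop (1 / 20))).exists
    exact ⟨T, hT', fun z h1 h2 => (hK z T hT' h1 h2).trans_lt hT⟩
  set U := {p : ℂ × ℂ | 0 < p.1.im ∧ 0 < p.2.im} with hU
  set G : ℂ × ℂ → ℂ := fun p => f (ofComplex p.1, ofComplex p.2) with hG
  have hUo : IsOpen U := (isOpen_lt continuous_const (Complex.continuous_im.comp continuous_fst)).inter
    (isOpen_lt continuous_const (Complex.continuous_im.comp continuous_snd))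
  have hGz : ∀ z : ℍ × ℍ, G (z.1, z.2) = f z := fun z => by
    rw [hG]; simp [ofComplex_apply]
  have hzU : ∀ z : ℍ × ℍ, ((z.1 : ℂ), (z.2 : ℂ)) ∈ U := fun z => ⟨z.1.im_pos, z.2.im_pos⟩
  set B : Set ((ℝ × ℝ) × (ℝ × ℝ)) := (Set.Icc (-(1 / 2)) (1 / 2) ×ˢ Set.Icc (-(1 / 2)) (1 / 2)) ×ˢ
    (Set.Icc (1 / 20) (7 * T) ×ˢ Set.Icc (1 / 20) (7 * T)) with hB
  have hBc : IsCompact B := (isCompact_Icc.prod isCompact_Icc).prod (isCompact_Icc.prod isCompact_Icc)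
  set P : (ℝ × ℝ) × (ℝ × ℝ) → ℂ × ℂ := fun x =>
    (((x.1.1 + x.1.2 * t₁ : ℝ) : ℂ) + x.2.1 * I, ((x.1.1 + x.1.2 * t₂ : ℝ) : ℂ) + x.2.2 * I) with hP
  have hPc : Continuous P := by rw [hP]; fun_prop
  have hPU : Set.MapsTo P B U := by
    rintro x ⟨-, hx1, hx2⟩
    constructor
    · simp only [hP, im_add_mul_I]; linarith [hx1.1]
    · simp only [hP, im_add_mul_I]; linarith [hx2.1]
  have hred : ∀ z : ℍ × ℍ, ‖f z‖ < ε ∨ ∃ x ∈ B, G (P x) = f z := fun z => by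
    obtain ⟨M, hM, hM2⟩ := exists_reduced z
    rw [← hinv M z]
    generalize act M z = z' at *
    rcases le_total T z'.2.im with h | h
    · exact Or.inl (hT2 z' (h.trans hM.le_im) h)
    · right
      obtain ⟨u, v, hu, hv, e1, e2⟩ := hM.re_mem
      have h1 := hM.le_im
      have h2 := hM.im_le
      refine ⟨((u, v), (z'.1.im, z'.2.im)), ⟨⟨abs_le.1 hu, abs_le.1 hv⟩, ⟨by linarith, by linarith⟩,
        ⟨by linarith, by linarith⟩⟩, ?_⟩
      rw [← hGz z', hP]
      simp only
      rw [← e1, ← e2]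
      congr 2
      · exact Complex.re_add_im _
      · exact Complex.re_add_im _
  have hcont : ContinuousOn (fun x => ‖G (P x)‖) B :=
    (hf.holomorphic.continuousOn.comp hPc.continuousOn hPU).norm
  obtain ⟨x₀, hx₀, hGx₀⟩ := (hred z₀).resolve_left (lt_irrefl _)
  obtain ⟨x, hx, hmax⟩ := hBc.exists_isMaxOn ⟨x₀, hx₀⟩ hcont
  have hle : ∀ z, ‖f z‖ ≤ ‖G (P x)‖ := fun z => by
    rcases hred z with h | ⟨y, hy, hy2⟩
    · refine h.le.trans ?_
      rw [hε, ← hGx₀]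
      exact hmax hx₀
    · rw [← hy2]
      exact hmax hy
  have hmaxU : IsMaxOn (norm ∘ G) U (P x) := fun p hp => hle _
  have hconst := Complex.eqOn_of_isPreconnected_of_isMaxOn_norm isPreconnected_upperHalfPlane_prod
    hUo hf.holomorphic (hPU hx) hmaxU
  have e1 := hconst (hzU z₀)
  set τ : ℍ := ⟨T * I, by simp; linarith⟩ with hτ
  have hτim : τ.im = T := by rw [hτ]; simp [UpperHalfPlane.im]
  have e2 := hconst (hzU (τ, τ))
  have e3 : f z₀ = f (τ, τ) := by rw [← hGz z₀, ← hGz (τ, τ)]; exact e1.trans e2.symm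
  have := hT2 (τ, τ) hτim.ge hτim.ge
  rw [← e3] at this
  exact lt_irrefl _ this

end GoldenHilbert
end

noncomputable section

namespace GoldenHilbert

open Complex TorusFourier
open UpperHalfPlane hiding I

variable {w : ℕ} {f g : ℍ × ℍ → ℂ}

lemma isSymmetricHilbertModularForm_one : IsSymmetricHilbertModularForm 0 1 where
  holomorphic := differentiableOn_const 1
  transform M z := by simp
  symm z₁ z₂ := rfl

lemma IsSymmetricHilbertModularForm.sub (hf : IsSymmetricHilbertModularForm w f)
    (hg : IsSymmetricHilbertModularForm w g) : IsSymmetricHilbertModularForm w (f - g) where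
  holomorphic := hf.holomorphic.sub hg.holomorphic
  transform M z := by rw [Pi.sub_apply, Pi.sub_apply, hf.transform, hg.transform, mul_sub]
  symm z₁ z₂ := by rw [Pi.sub_apply, Pi.sub_apply, hf.symm, hg.symm]

lemma coeffAt_sub (hf : PeriodicOnTube (cover f)) (hg : PeriodicOnTube (cover g)) (m n : ℤ) :
    coeffAt (f - g) m n = coeffAt f m n - coeffAt g m n := by
  have hQ := posCone_one_zero one_pos
  have h1 := (periodicOnTube_twist hf m n).continuous hQ
  have h2 := (periodicOnTube_twist hg m n).continuous hQ
  have h3 : atHeight (twist (f - g) m n) 1 0 =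
      fun x y => atHeight (twist f m n) 1 0 x y + (-1) * atHeight (twist g m n) 1 0 x y := by
    ext x y
    rw [neg_one_mul, ← sub_eq_add_neg]
    exact mul_sub _ _ _
  rw [coeffAt, coeffAt, coeffAt, h3]
  generalize atHeight (twist f m n) 1 0 = F at *
  generalize atHeight (twist g m n) 1 0 = G at *
  have h4 : Continuous (Function.uncurry fun x y => (-1) * G x y) :=
    (continuous_const.mul h2 : Continuous fun p : ℝ × ℝ => (-1) * Function.uncurry G p)
  refine (torusMean_add h1 h4).trans ?_
  rw [torusMean_const_mul, neg_one_mul, sub_eq_add_neg]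

lemma coeffAt_one (m n : ℤ) : coeffAt 1 m n = if m = 0 ∧ n = 0 then 1 else 0 := by
  have h : atHeight (twist 1 m n) 1 0 = fun x y : ℝ =>
      ef (-(m * I)) * (ef ((-m : ℤ) * x) * ef ((-n : ℤ) * y)) := by
    ext x y
    rw [← ef_add, ← ef_add]
    simp only [atHeight, twist, cover, Pi.one_apply, mul_one]
    congr 1
    push_cast
    ring
  rw [coeffAt, h, torusMean_const_mul, torusMean_mul (fun x : ℝ => ef ((-m : ℤ) * x))
    (fun y : ℝ => ef ((-n : ℤ) * y))]
  split_ifs with h0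
  · simp [h0.1, h0.2, ef_zero]
  · rcases not_and_or.1 h0 with h0 | h0
    · rw [integral_ef_eq_zero (neg_ne_zero.2 h0), zero_mul, mul_zero]
    · rw [integral_ef_eq_zero (neg_ne_zero.2 h0), mul_zero, mul_zero]

lemma mem_qSupport (g : ℍ × ℍ → ℂ) (i j : ℤ) :
    toLex (i, j) ∈ qSupport g ↔ coeffAt g i (j - 3 * i) ≠ 0 := by
  constructor
  · rintro ⟨⟨x, y⟩, h1, h2, h3⟩
    rw [traceEtaInv_mk] at h2
    rw [trace_mk] at h3
    rw [hilbertCoeff_mk] at h1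
    have h2' : x - y = i := by exact_mod_cast h2
    have h3' : 2 * x - y = j := by exact_mod_cast h3
    rwa [← h2', ← h3', show 2 * x - y - 3 * (x - y) = 2 * y - x by ring]
  · intro h
    refine ⟨⟨j - i, j - 2 * i⟩, ?_, ?_, ?_⟩
    · rw [hilbertCoeff_mk]
      convert! h using 2 <;> ring
    · rw [traceEtaInv_mk, ofLex_toLex]; push_cast; ring
    · rw [trace_mk, ofLex_toLex]; push_cast; ring

/-- The coefficients of `f - 1`. -/
lemma IsHilbertModularForm.coeffAt_sub_one (hf : IsHilbertModularForm w f) (m n : ℤ) :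
    coeffAt (f - 1) m n = coeffAt f m n - if m = 0 ∧ n = 0 then 1 else 0 := by
  rw [coeffAt_sub hf.periodicOnTube isSymmetricHilbertModularForm_one.periodicOnTube, coeffAt_one]

lemma IsSymmetricHilbertModularForm.coeffAt_sub_one_conj (hf : IsSymmetricHilbertModularForm w f)
    (m n : ℤ) : coeffAt (f - 1) m (-m - n) = coeffAt (f - 1) m n := by
  have h : (m = 0 ∧ -m - n = 0) ↔ (m = 0 ∧ n = 0) := by omega
  rw [hf.coeffAt_sub_one, hf.coeffAt_sub_one, hf.coeffAt_conj, if_congr h rfl rfl]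

lemma IsHilbertModularForm.coeffAt_sub_one_theta (hf : IsHilbertModularForm w f) {m n : ℤ}
    (h : coeffAt (f - 1) m n ≠ 0) : coeffAt (f - 1) (m - n) (2 * n - m) ≠ 0 := by
  by_cases h0 : m = 0 ∧ n = 0
  · simpa [h0.1, h0.2] using h
  · have h0' : ¬(m - n = 0 ∧ 2 * n - m = 0) := by omega
    rw [hf.coeffAt_sub_one, if_neg h0, sub_zero] at h
    rw [hf.coeffAt_sub_one, if_neg h0', sub_zero, hf.coeffAt_theta]
    exact mul_ne_zero (pow_ne_zero _ (by norm_num)) h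

lemma IsSymmetricHilbertModularForm.cone_of_coeffAt_sub_one_ne_zero
    (hf : IsSymmetricHilbertModularForm w f) {m n : ℤ} (h : coeffAt (f - 1) m n ≠ 0) :
    0 ≤ m ∧ -(2 * m) ≤ n := by
  by_cases h0 : m = 0 ∧ n = 0
  · omega
  · rw [hf.coeffAt_sub_one, if_neg h0, sub_zero] at h
    have h1 := abs_add_abs_le_of_cone (hf.koecher h)
    have h2 : |m| + |n| ≤ 3 * m := by exact_mod_cast h1.2
    have h3 := le_abs_self m
    have h4 := neg_abs_le n
    exact ⟨h1.1, by omega⟩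

theorem IsSymmetricHilbertModularForm.exists_coeffAt_sub_one_ne_zero
    (hf : IsSymmetricHilbertModularForm w f) (hf1 : f ≠ 1) :
    ∃ m n : ℤ, m ≤ w / 6 + 1 ∧ coeffAt (f - 1) m n ≠ 0 := by
  by_cases h0 : coeffAt (f - 1) 0 0 = 0
  · rcases eq_or_ne w 0 with rfl | hw
    · exact absurd (sub_eq_zero.1
        ((hf.sub isSymmetricHilbertModularForm_one).eq_zero_of_weight_zero h0)) hf1
    · have h1 : coeffAt f 0 0 = 1 := by
        rwa [hf.coeffAt_sub_one, if_pos ⟨rfl, rfl⟩, sub_eq_zero] at h0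
      obtain ⟨m, n, hm0, hm, hmn⟩ := hf.exists_coeffAt_ne_zero hw h1
      refine ⟨m, n, hm, ?_⟩
      rwa [hf.coeffAt_sub_one, if_neg (fun h => hm0 h.1), sub_zero]
  · exact ⟨0, 0, by positivity, h0⟩

theorem IsSymmetricHilbertModularForm.exists_hasNu (hf : IsSymmetricHilbertModularForm w f)
    (hf1 : f ≠ 1) : ∃ i j : ℤ, HasNu (f - 1) i j ∧ i ≤ w / 6 + 1 ∧ 2 * j ≤ 5 * i ∧ 2 * i ≤ j := by
  obtain ⟨m, n, hm, hmn⟩ := hf.exists_coeffAt_sub_one_ne_zero hf1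
  obtain ⟨i, ⟨n', hi⟩, hi'⟩ := Int.exists_least_of_bdd
    (P := fun i => ∃ n, coeffAt (f - 1) i n ≠ 0)
    ⟨0, fun _ ⟨_, h⟩ => (hf.cone_of_coeffAt_sub_one_ne_zero h).1⟩ ⟨m, n, hmn⟩
  obtain ⟨k, hk, hk'⟩ := Int.exists_least_of_bdd (P := fun n => coeffAt (f - 1) i n ≠ 0)
    ⟨-(2 * i), fun _ h => (hf.cone_of_coeffAt_sub_one_ne_zero h).2⟩ ⟨n', hi⟩
  have h1 : k ≤ -i - k := hk' _ (by rwa [hf.coeffAt_sub_one_conj])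
  have h2 : i ≤ i - (-i - k) :=
    hi' _ ⟨_, hf.coeffAt_sub_one_theta (n := -i - k) (by rwa [hf.coeffAt_sub_one_conj])⟩
  refine ⟨i, 3 * i + k, ⟨?_, ?_⟩, (hi' _ ⟨n, hmn⟩).trans hm, by omega, by omega⟩
  · rw [mem_qSupport]
    simpa using hk
  · intro p hp
    obtain ⟨⟨a, b⟩, rfl⟩ := toLex.surjective p
    rw [mem_qSupport] at hp
    rw [Prod.Lex.toLex_le_toLex]
    rcases (hi' a ⟨_, hp⟩).lt_or_eq with h | rfl
    · exact Or.inl h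
    · have := hk' _ hp
      exact Or.inr ⟨rfl, by simp only; omega⟩

end GoldenHilbert
end

theorem proposition2p7 (w : ℕ) (f : UpperHalfPlane × UpperHalfPlane → ℂ)
    (hf : GoldenHilbert.IsSymmetricHilbertModularForm w f) (hf1 : f ≠ 1)
    (s t : ℤ) (hs : s = 1 + ⌊(w : ℚ) / 6⌋) (ht : t = ⌊5 * (s : ℚ) / 2⌋) :
    ∃ s' t' : ℤ, GoldenHilbert.HasNu (f - 1) s' t' ∧
      s' ≤ s ∧
      t' ≤ ⌊5 * (s' : ℚ) / 2⌋ ∧ 2 * s' ≤ t' ∧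
      toLex (s', t') ≤ toLex (s, t) := by
  obtain ⟨i, j, hν, hi, hj, hij⟩ := hf.exists_hasNu hf1
  have his : i ≤ s := by
    have h1 : (w : ℤ) / 6 ≤ ⌊(w : ℚ) / 6⌋ := by
      rw [Int.le_floor, le_div_iff₀ (by norm_num)]
      have : (w : ℤ) / 6 * 6 ≤ w := by omega
      exact_mod_cast this
    omega
  have hjf : j ≤ ⌊5 * (i : ℚ) / 2⌋ := by
    rw [Int.le_floor, le_div_iff₀ (by norm_num)]
    have : j * 2 ≤ 5 * i := by omega
    exact_mod_cast this
  refine ⟨i, j, hν, his, hjf, hij, ?_⟩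
  rw [Prod.Lex.toLex_le_toLex]
  rcases his.lt_or_eq with h | rfl
  · exact Or.inl h
  · exact Or.inr ⟨rfl, by rw [ht]; exact hjf⟩
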